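/- Let $k$ be a field and let $G$ be a finite simple graph (no loops or multiple edges, not necessarily connected) with vertex set $V=\{x_1,\dots,x_n\}$. Let $R=k[x_1,\dots,x_n]$ with the standard grading, and let $I(G)=\langle x_ax_b : \{x_a,x_b\}\text{ is an edge of }G\rangle\subseteq R$ be the edge ideal of $G$. For a homogeneous ideal $I\subseteq R$ let $\beta_{i,j}(I)=\dim_k \operatorname{Tor}^R_i(I,k)_j$ denote its graded Betti numbers, where $k=R/(x_1,\dots,x_n)$; here $\operatorname{Tor}^R_i(I,k)_j$ is the degree $j$ component of the $i$-th homology of $F_\bullet\otimes_R k$, for any resolution $F_\bullet\to I\to 0$ of $I$ by finitely generated graded free $R$-modules with maps homogeneous of degree $0$. For $S\subseteq V$ let $G_S$ be the induced subgraph of $G$ on $S$ and let $(G_S)^c$ be its complement. For a graph $H$ let $\Delta(H)$ be its clique complex, i.e. the simplicial complex on the vertices of $H$ whose faces are the sets of pairwise adjacent vertices (including $\emptyset$), and let $\widetilde H_m(\Delta,k)$ denote reduced simplicial homology with coefficients in $k$, computed from the augmented simplicial chain complex, in which $\emptyset$ is a face of dimension $-1$ (so that $\widetilde H_m=0$ for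 $m<-1$). Then $I(G)$ has such a graded free resolution, and for all integers $i,j\ge 0$ (whichever such resolution is used to compute the left-hand side) $$\beta_{i,j}(I(G))=\sum_{S\subseteq V,\ |S|=j}\dim_k\widetilde H_{j-i-2}\bigl(\Delta((G_S)^c),k\bigr).$$ -/

import Mathlib

open scoped TensorProduct

noncomputable section

namespace EdgeIdeal

/-- The subquotient `Z / (Z ∩ B)` of a vector space; it is `Z / B` when `B ≤ Z`. -/
abbrev Subquotient {k M : Type*} [Field k] [AddCommGroup M] [Module k M]
    (Z B : Submodule k M) : Type _ :=
  ↥Z ⧸ B.submoduleOf Z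

/-! ### The algebraic side: edge ideals, graded free resolutions and graded Betti numbers -/

section Algebra

variable (k : Type*) [Field k] {V : Type*}

/-- The edge ideal `I(G) = ⟨x_a x_b : {a, b} an edge of G⟩` in the polynomial ring over `k` with
one variable for each vertex of `G`. -/
def edgeIdeal (G : SimpleGraph V) : Ideal (MvPolynomial V k) :=
  Ideal.span {f | ∃ a b : V, G.Adj a b ∧ f = MvPolynomial.X a * MvPolynomial.X b}

variable (V) in
/-- The field `k`, regarded as the module `R / (x_v : v ∈ V)` over `R = k[x_v : v ∈ V]`. -/
abbrev ResidueModule : Type _ :=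
  MvPolynomial V k ⧸ Ideal.span (Set.range (MvPolynomial.X : V → MvPolynomial V k))

/-- The homogeneous component of degree `j` of the graded free module
`R(-s₁) ⊕ ⋯ ⊕ R(-s_r)`, where `R` has the standard grading: the vectors whose `b`-th entry is
homogeneous of degree `j - s_b` (and zero if `j - s_b < 0`). -/
def gradedPiece {r : ℕ} (s : Fin r → ℤ) (j : ℤ) : Submodule k (Fin r → MvPolynomial V k) where
  carrier := {x | ∀ (b : Fin r) (m : V →₀ ℕ),
    MvPolynomial.coeff m (x b) ≠ 0 → (m.degree : ℤ) + s b = j}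
  zero_mem' := by simp
  add_mem' := by
    intro x y hx hy b m h
    by_cases h0 : MvPolynomial.coeff m (x b) = 0
    · exact hy b m (by simpa [h0] using h)
    · exact hx b m h0
  smul_mem' := by
    intro c x hx b m h
    exact hx b m (by intro h0; simp [h0] at h)

variable {k}

/-- A graded free resolution
`⋯ ⟶ F₂ ⟶ F₁ ⟶ F₀ ⟶ I ⟶ 0`
of an ideal `I` of `R = k[x_v : v ∈ V]`, where each `Fᵢ` is the finitely generated graded free
module `⨁_b R(-shift i b)`, and all maps are homogeneous of degree zero. -/
structure GradedFreeResolution (I : Ideal (MvPolynomial V k)) where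
  /-- the rank of the `i`-th free module -/
  rank : ℕ → ℕ
  /-- the degrees of the standard basis vectors of the `i`-th free module -/
  shift : (i : ℕ) → Fin (rank i) → ℤ
  /-- the differentials -/
  d : (i : ℕ) → (Fin (rank (i + 1)) → MvPolynomial V k) →ₗ[MvPolynomial V k]
    (Fin (rank i) → MvPolynomial V k)
  /-- the augmentation -/
  aug : (Fin (rank 0) → MvPolynomial V k) →ₗ[MvPolynomial V k] I
  d_homogeneous : ∀ (i : ℕ) (j : ℤ), ∀ x ∈ gradedPiece k (shift (i + 1)) j,
    d i x ∈ gradedPiece k (shift i) j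
  aug_homogeneous : ∀ (j : ℤ), ∀ x ∈ gradedPiece k (shift 0) j, ∀ m : V →₀ ℕ,
    MvPolynomial.coeff m (aug x : MvPolynomial V k) ≠ 0 → (m.degree : ℤ) = j
  exact_d : ∀ i : ℕ, Function.Exact (d (i + 1)) (d i)
  exact_aug : Function.Exact (d 0) aug
  aug_surjective : Function.Surjective aug

namespace GradedFreeResolution

variable {I : Ideal (MvPolynomial V k)} (F : GradedFreeResolution I)

/-- The `i`-th term `Fᵢ ⊗_R k` of the complex `F ⊗_R k`. -/
abbrev TorTerm (i : ℕ) : Type _ :=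
  (Fin (F.rank i) → MvPolynomial V k) ⊗[MvPolynomial V k] ResidueModule k V

/-- The differential `F_{i+1} ⊗_R k ⟶ F_i ⊗_R k`, as a `k`-linear map. -/
def torD (i : ℕ) : F.TorTerm (i + 1) →ₗ[k] F.TorTerm i :=
  (LinearMap.rTensor (ResidueModule k V) (F.d i)).restrictScalars k

/-- The degree `j` component of `Fᵢ ⊗_R k`, where `k` is concentrated in degree `0`: the set of
all `x ⊗ 1` with `x` in the degree `j` component of `Fᵢ`. -/
def torTermPiece (i : ℕ) (j : ℤ) : Submodule k (F.TorTerm i) :=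
  (gradedPiece k (F.shift i) j).map
    (((TensorProduct.mk (MvPolynomial V k) (Fin (F.rank i) → MvPolynomial V k)
      (ResidueModule k V)).flip 1).restrictScalars k)

/-- The `i`-cycles of `F ⊗_R k`; every element of `F₀ ⊗_R k` is a cycle. -/
def torCycles : (i : ℕ) → Submodule k (F.TorTerm i)
  | 0 => ⊤
  | i + 1 => LinearMap.ker (F.torD i)

/-- `Tor_i^R(I, k)_j`, computed from the graded free resolution `F` of `I`: the degree `j`
component of the `i`-th homology of `F ⊗_R k`, that is, the `i`-cycles of degree `j` modulo the
image of the component of degree `j` of `F_{i+1} ⊗_R k`. -/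
abbrev Tor (i : ℕ) (j : ℤ) : Type _ :=
  Subquotient (F.torCycles i ⊓ F.torTermPiece i j) ((F.torTermPiece (i + 1) j).map (F.torD i))

/-- The graded Betti number `β_{i,j}(I) = dim_k Tor_i^R(I, k)_j`. -/
def gradedBetti (i : ℕ) (j : ℤ) : ℕ := Module.finrank k (F.Tor i j)

end GradedFreeResolution

end Algebra

/-! ### The topological side: clique complexes and reduced simplicial homology -/

section Topology

/-- The clique complex of a graph `H`: the faces are the sets of vertices that are pairwise
adjacent in `H`. (In Mathlib, the empty face of a simplicial complex is left implicit.) -/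
def cliqueComplex {W : Type*} (H : SimpleGraph W) : AbstractSimplicialComplex W where
  faces := {s | s.Nonempty ∧ H.IsClique (s : Set W)}
  isRelLowerSet_faces := by
    rintro s ⟨hs, hc⟩
    exact ⟨hs, fun t hts ht => ⟨ht, hc.subset (by exact_mod_cast hts)⟩⟩
  singleton_mem := fun v => ⟨Finset.singleton_nonempty v, by simp⟩

variable (k : Type*) [Field k] {W : Type*} [LinearOrder W]

/-- The simplicial boundary map on the vector space with basis the finite subsets of the ordered
set `W`, including the empty one:
`∂{v₀ < ⋯ < v_n} = ∑ᵢ (-1)^i {v₀, …, v_n} \ {vᵢ}`; in particular `∂{v} = ∅` and `∂∅ = 0`. -/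
def boundary : (Finset W →₀ k) →ₗ[k] (Finset W →₀ k) :=
  Finsupp.lsum k fun s => LinearMap.toSpanSingleton k (Finset W →₀ k)
    (∑ v ∈ s, Finsupp.single (s.erase v) ((-1 : k) ^ (s.filter (· < v)).card))

/-- The `n`-chains of the augmented simplicial chain complex of `K` over `k`: the span of the
faces of dimension `n` (with `n + 1` vertices), where the empty set is a face of dimension `-1`. -/
def chains (K : AbstractSimplicialComplex W) (n : ℤ) : Submodule k (Finset W →₀ k) :=
  Finsupp.supported k k {s | (s = ∅ ∨ s ∈ K) ∧ (s.card : ℤ) = n + 1}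

/-- The reduced simplicial homology `H̃_n(K, k)`, for every integer `n`. -/
abbrev ReducedHomology (K : AbstractSimplicialComplex W) (n : ℤ) : Type _ :=
  Subquotient (LinearMap.ker (boundary k) ⊓ chains k K n)
    ((chains k K (n + 1)).map (boundary k))

end Topology

end EdgeIdeal

end

noncomputable section

namespace EdgeIdeal

/-! ### Subquotients -/

section Subquotient

variable {k E E' : Type*} [Field k] [AddCommGroup E] [Module k E] [AddCommGroup E'] [Module k E']

/-! The proof is Hochster's: balance Tor between a resolution and the Koszul complex, then split
Koszul homology by multidegree.

Put `R` in front of the given resolution of `I = I(G)`; tensoring with the Koszul complex `K` of the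
variables gives a double complex with exact rows and columns away from its edges. `Tor_i(I, k)_j`
sits at the spot `(i + 1, 0)`, and the degree `j` part of the homology `H_{i+1}(K ⊗ R/I)` at the
spot `(0, i + 1)`. Moving along the antidiagonal one corner at a time shows that both have the same
dimension (`finrank_cyclesD`, `GradedFreeResolution.gradedBetti_eq`). This holds for every
resolution, so no comparison of resolutions is needed.

Since `I` is a monomial ideal, `K ⊗ R/I` splits by multidegree. If some exponent is at least 2,
dividing by that variable and wedging with its exterior generator is a contracting homotopy that
respects `I` (`exists_koszul_homotopy`, `exists_sub_koszulD_mem_edgeIdeal`). In the multidegree of a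
set `S` with `|S| = j`, the surviving basis elements are `x^T e_{S \ T}` with `T ⊆ S` independent,
that is, `T` a face of the clique complex of `(G_S)^c`. Up to signs the Koszul differential is the
coboundary (`toCochain_koszulD`), and `|S \ T| = i + 1` means `dim T = j - i - 2`. So Koszul
homology is the sum over `S` of reduced cohomology, the dual of reduced homology over a field
(`gradedBetti_eq_sum`).

Existence of a resolution is Hilbert's: iterate homogeneous syzygies over a Noetherian ring. -/

theorem finrank_subquotient_of_surjective {Z B : Submodule k E} (g : Z →ₗ[k] E')
    (hg : Function.Surjective g) (hker : ∀ x, g x = 0 ↔ (x : E) ∈ B) :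
    Module.finrank k (Subquotient Z B) = Module.finrank k E' := by
  have h : B.submoduleOf Z = LinearMap.ker g := by
    ext x
    rw [LinearMap.mem_ker, hker]
    rfl
  exact ((Submodule.quotEquivOfEq _ _ h).trans (g.quotKerEquivOfSurjective hg)).finrank_eq

/-- A linear map whose kernel meets `Z` inside `B` identifies `Z / B` with its image. -/
theorem finrank_subquotient_map (f : E →ₗ[k] E') {Z B : Submodule k E} (hBZ : B ≤ Z)
    (hf : LinearMap.ker f ⊓ Z ≤ B) :
    Module.finrank k (Subquotient Z B) = Module.finrank k (Subquotient (Z.map f) (B.map f)) := by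
  refine finrank_subquotient_of_surjective
    (((B.map f).submoduleOf (Z.map f)).mkQ ∘ₗ f.submoduleMap Z)
    ((Submodule.mkQ_surjective _).comp (f.submoduleMap_surjective Z)) fun x => ?_
  rw [LinearMap.comp_apply, Submodule.mkQ_apply, Submodule.Quotient.mk_eq_zero,
    Submodule.submoduleOf, Submodule.mem_comap, Submodule.subtype_apply,
    LinearMap.submoduleMap_coe_apply, Submodule.mem_map]
  constructor
  · rintro ⟨b, hb, hbx⟩
    have : (x : E) - b ∈ B := hf ⟨by simp [hbx], Z.sub_mem x.2 (hBZ hb)⟩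
    simpa using B.add_mem this hb
  · exact fun h => ⟨x, h, rfl⟩

/-- A functional on `W` that kills the kernel of `f` on `W` factors through `f(W)`, and over a field
it extends from there. With `f` the boundary, a cochain vanishing on cycles is a coboundary. -/
theorem exists_dual_eq_comp {f : E →ₗ[k] E'} {W : Submodule k E} {φ : Module.Dual k E}
    (h : ∀ x ∈ LinearMap.ker f ⊓ W, φ x = 0) :
    ∃ g : Module.Dual k E', ∀ x ∈ W, φ x = g (f x) := by
  have : φ ∘ₗ W.subtype ∈ LinearMap.range (f ∘ₗ W.subtype).dualMap := by
    rw [LinearMap.range_dualMap_eq_dualAnnihilator_ker, Submodule.mem_dualAnnihilator]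
    exact fun x hx => h x ⟨hx, x.2⟩
  obtain ⟨g, hg⟩ := this
  exact ⟨g, fun x hx => (LinearMap.congr_fun hg ⟨x, hx⟩).symm⟩

theorem finrank_pi_dualAnnihilator {ι : Type*} [Fintype ι] {M : ι → Type*}
    [∀ i, AddCommGroup (M i)] [∀ i, Module k (M i)] [∀ i, FiniteDimensional k (M i)]
    (Z B : ∀ i, Submodule k (M i)) :
    Module.finrank k (∀ i, ((B i).submoduleOf (Z i)).dualAnnihilator) =
      ∑ i, Module.finrank k (Subquotient (Z i) (B i)) := by
  rw [(LinearEquiv.piCongrRight fun i =>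
    (Submodule.dualQuotEquivDualAnnihilator ((B i).submoduleOf (Z i))).symm).finrank_eq,
    Module.finrank_pi_fintype]
  exact Finset.sum_congr rfl fun i _ => Subspace.dual_finrank_eq

end Subquotient

/-! ### Signs -/

section Sign

variable (k : Type*) [Field k] {V : Type*} [LinearOrder V]

/-- The sign with which the face opposite to `u` enters the boundary of `σ`. -/
def sgn (u : V) (σ : Finset V) : k := (-1) ^ (σ.filter (· < u)).card

variable {k}

theorem sgn_mul_self (u : V) (σ : Finset V) : sgn k u σ * sgn k u σ = 1 := by
  rw [sgn, ← pow_add, ← two_mul, pow_mul]; simp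

theorem sgn_insert_self (u : V) (σ : Finset V) : sgn k u (insert u σ) = sgn k u σ := by
  rw [sgn, sgn, Finset.filter_insert]; simp

theorem sgn_erase_self (u : V) (σ : Finset V) : sgn k u (σ.erase u) = sgn k u σ := by
  rw [sgn, sgn, Finset.filter_erase, Finset.erase_eq_of_notMem]; simp

theorem sgn_insert_of_lt {u v : V} {σ : Finset V} (hv : v ∉ σ) (h : v < u) :
    sgn k u (insert v σ) = - sgn k u σ := by
  rw [sgn, sgn, Finset.filter_insert, if_pos h, Finset.card_insert_of_notMem (by simp [hv]),
    pow_succ]; simp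

theorem sgn_insert_of_gt {u v : V} {σ : Finset V} (h : u < v) :
    sgn k u (insert v σ) = sgn k u σ := by
  rw [sgn, sgn, Finset.filter_insert, if_neg h.not_gt]

/-- The sign rule behind all three cancellations below: both differentials square to zero, and the
Koszul homotopy contracts. -/
theorem sgn_insert_mul {u v : V} {σ : Finset V} (huv : u ≠ v) (hu : u ∉ σ) (hv : v ∉ σ) :
    sgn k u (insert v σ) * sgn k v σ = - (sgn k v (insert u σ) * sgn k u σ) := by
  rcases lt_or_gt_of_ne huv with h | h
  · rw [sgn_insert_of_gt h, sgn_insert_of_lt hu h]; ring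
  · rw [sgn_insert_of_gt h, sgn_insert_of_lt hv h]; ring

theorem sgn_sdiff_mul {S τ : Finset V} (h : τ ⊆ S) (u : V) :
    sgn k u (S \ τ) * sgn k u τ = sgn k u S := by
  rw [sgn, sgn, sgn, ← pow_add, ← Finset.card_union_of_disjoint, ← Finset.filter_union,
    Finset.sdiff_union_of_subset h]
  exact Finset.disjoint_filter_filter Finset.sdiff_disjoint

end Sign

/-! ### Graded free modules -/

section Graded

variable (k : Type*) [Field k] {V : Type*} {r : ℕ}

/-- The projection of a graded free module onto its component of degree `j`. -/
def gradedProj (s : Fin r → ℤ) (j : ℤ) :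
    (Fin r → MvPolynomial V k) →ₗ[k] (Fin r → MvPolynomial V k) :=
  LinearMap.pi fun b =>
    (if 0 ≤ j - s b then MvPolynomial.homogeneousComponent (j - s b).toNat else 0) ∘ₗ
      LinearMap.proj b

theorem coeff_gradedProj (s : Fin r → ℤ) (j : ℤ) (x : Fin r → MvPolynomial V k) (b : Fin r)
    (m : V →₀ ℕ) :
    MvPolynomial.coeff m (gradedProj k s j x b) =
      if (m.degree : ℤ) + s b = j then MvPolynomial.coeff m (x b) else 0 := by
  simp only [gradedProj, LinearMap.pi_apply, LinearMap.comp_apply, LinearMap.proj_apply]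
  split_ifs with h1 h2 h2
  · rw [MvPolynomial.coeff_homogeneousComponent, if_pos (by omega)]
  · rw [MvPolynomial.coeff_homogeneousComponent, if_neg (by omega)]
  · omega
  · simp

theorem gradedProj_mem (s : Fin r → ℤ) (j : ℤ) (x : Fin r → MvPolynomial V k) :
    gradedProj k s j x ∈ gradedPiece k s j := by
  intro b m h
  rw [coeff_gradedProj] at h
  by_contra hne
  exact h (if_neg hne)

variable {k}

theorem gradedProj_of_mem {s : Fin r → ℤ} {j : ℤ} {x : Fin r → MvPolynomial V k}
    (h : x ∈ gradedPiece k s j) : gradedProj k s j x = x := by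
  ext b m
  rw [coeff_gradedProj]
  split_ifs with h1
  · rfl
  · by_contra h2
    exact h1 (h b m (Ne.symm h2))

theorem gradedProj_of_mem_of_ne {s : Fin r → ℤ} {i j : ℤ} {x : Fin r → MvPolynomial V k}
    (h : x ∈ gradedPiece k s i) (hij : i ≠ j) : gradedProj k s j x = 0 := by
  ext b m
  rw [coeff_gradedProj]
  split_ifs with h1
  · by_contra h2
    exact hij ((h b m (by simpa using h2)).symm.trans h1)
  · rfl

theorem single_monomial_mem_gradedPiece (s : Fin r → ℤ) (b : Fin r) (m : V →₀ ℕ) (c : k) :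
    (Pi.single b (MvPolynomial.monomial m c) : Fin r → MvPolynomial V k) ∈
      gradedPiece k s (m.degree + s b) := by
  classical
  intro b' m' h
  by_cases hb : b' = b
  · subst hb
    rw [Pi.single_eq_same, MvPolynomial.coeff_monomial] at h
    by_cases hm : m = m'
    · rw [hm]
    · simp [hm] at h
  · simp [hb] at h

theorem linearMap_ext_single_monomial {M : Type*} [AddCommGroup M] [Module k M]
    {f g : (Fin r → MvPolynomial V k) →ₗ[k] M}
    (h : ∀ b m c, f (Pi.single b (MvPolynomial.monomial m c)) =
      g (Pi.single b (MvPolynomial.monomial m c))) : f = g :=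
  LinearMap.pi_ext' fun b => MvPolynomial.linearMap_ext fun m => LinearMap.ext fun c => h b m c

/-- Both sides are linear, so monomial vectors suffice, and each of these lies in a single degree.
This lets arbitrary preimages be replaced by homogeneous ones. -/
theorem map_gradedProj {r' : ℕ} {s : Fin r → ℤ} {s' : Fin r' → ℤ}
    {f : (Fin r → MvPolynomial V k) →ₗ[MvPolynomial V k] (Fin r' → MvPolynomial V k)}
    (hf : ∀ j, ∀ x ∈ gradedPiece k s j, f x ∈ gradedPiece k s' j) (j : ℤ)
    (x : Fin r → MvPolynomial V k) : f (gradedProj k s j x) = gradedProj k s' j (f x) := by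
  have : f.restrictScalars k ∘ₗ gradedProj k s j = gradedProj k s' j ∘ₗ f.restrictScalars k := by
    refine linearMap_ext_single_monomial fun b m c => ?_
    have hx := single_monomial_mem_gradedPiece s b m c
    simp only [LinearMap.comp_apply, LinearMap.restrictScalars_apply]
    by_cases hj : (m.degree : ℤ) + s b = j
    · rw [gradedProj_of_mem (hj ▸ hx), gradedProj_of_mem (hf _ _ (hj ▸ hx))]
    · rw [gradedProj_of_mem_of_ne hx hj, gradedProj_of_mem_of_ne (hf _ _ hx) hj, map_zero]
  exact LinearMap.congr_fun this x

theorem coeff_C_mul_X_mul [DecidableEq V] (m : V →₀ ℕ) (c : k) (u : V) (p : MvPolynomial V k) :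
    MvPolynomial.coeff m (MvPolynomial.C c * MvPolynomial.X u * p) =
      if m u ≠ 0 then c * MvPolynomial.coeff (m - Finsupp.single u 1) p else 0 := by
  rw [mul_assoc, MvPolynomial.coeff_C_mul, MvPolynomial.coeff_X_mul']
  simp only [Finsupp.mem_support_iff, mul_ite, mul_zero]

theorem degree_sub_single {m : V →₀ ℕ} {u : V} (h : m u ≠ 0) :
    (m - Finsupp.single u 1).degree + 1 = m.degree := by
  conv_rhs => rw [← tsub_add_cancel_of_le
    (show Finsupp.single u 1 ≤ m by rw [Finsupp.single_le_iff]; omega)]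
  rw [map_add, Finsupp.degree_single]

theorem gradedProj_smul (s : Fin r → ℤ) (j : ℤ) (c : k) (u : V)
    (x : Fin r → MvPolynomial V k) :
    gradedProj k s j ((MvPolynomial.C c * MvPolynomial.X u : MvPolynomial V k) • x) =
      (MvPolynomial.C c * MvPolynomial.X u : MvPolynomial V k) • gradedProj k s (j - 1) x := by
  classical
  ext b m
  rw [coeff_gradedProj, Pi.smul_apply, Pi.smul_apply, smul_eq_mul, smul_eq_mul,
    coeff_C_mul_X_mul, coeff_C_mul_X_mul, coeff_gradedProj]
  by_cases hu : m u = 0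
  · simp [hu]
  · have := degree_sub_single hu
    have : ((m - Finsupp.single u 1).degree : ℤ) + s b = j - 1 ↔ (m.degree : ℤ) + s b = j := by
      omega
    simp [hu, this]

end Graded

/-! ### The Koszul complex -/

section Koszul

variable {k : Type*} [Field k] {V : Type*} {r : ℕ}

/-- The strand of internal degree `j` and homological degree `q` of the Koszul complex of the
graded free module with shifts `s`. -/
def koszulPiece (s : Fin r → ℤ) (q : ℕ) (j : ℤ) :
    Submodule k (Finset V → Fin r → MvPolynomial V k) where
  carrier := {ω | ∀ σ, (σ.card = q → ω σ ∈ gradedPiece k s (j - q)) ∧ (σ.card ≠ q → ω σ = 0)}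
  zero_mem' := fun σ => ⟨fun _ => Submodule.zero_mem _, fun _ => rfl⟩
  add_mem' := by
    intro ω ω' h h' σ
    refine ⟨fun hσ => Submodule.add_mem _ ((h σ).1 hσ) ((h' σ).1 hσ), fun hσ => ?_⟩
    rw [Pi.add_apply, (h σ).2 hσ, (h' σ).2 hσ, add_zero]
  smul_mem' := by
    intro c ω h σ
    refine ⟨fun hσ => Submodule.smul_mem _ c ((h σ).1 hσ), fun hσ => ?_⟩
    rw [Pi.smul_apply, (h σ).2 hσ, smul_zero]

/-- The projection of the Koszul complex onto a strand. -/
def koszulProj (s : Fin r → ℤ) (q : ℕ) (j : ℤ) (ω : Finset V → Fin r → MvPolynomial V k) :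
    Finset V → Fin r → MvPolynomial V k :=
  fun σ => if σ.card = q then gradedProj k s (j - q) (ω σ) else 0

theorem koszulProj_mem (s : Fin r → ℤ) (q : ℕ) (j : ℤ)
    (ω : Finset V → Fin r → MvPolynomial V k) : koszulProj s q j ω ∈ koszulPiece s q j := by
  intro σ
  constructor <;> intro h
  · rw [koszulProj, if_pos h]; exact gradedProj_mem k _ _ _
  · rw [koszulProj, if_neg h]

theorem koszulProj_of_mem {s : Fin r → ℤ} {q : ℕ} {j : ℤ}
    {ω : Finset V → Fin r → MvPolynomial V k} (h : ω ∈ koszulPiece s q j) :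
    koszulProj s q j ω = ω := by
  funext σ
  rw [koszulProj]
  split_ifs with hσ
  · exact gradedProj_of_mem ((h σ).1 hσ)
  · exact ((h σ).2 hσ).symm

/-- Division by `x_u` of the part of `p` supported on the monomials selected by `Q`, all of which
are divisible by `x_u`. -/
theorem exists_coeff_eq_shift (p : MvPolynomial V k) (u : V) (Q : (V →₀ ℕ) → Prop)
    [DecidablePred Q] (hQ : ∀ m, Q m → m u ≠ 0) :
    ∃ p' : MvPolynomial V k, ∀ a, MvPolynomial.coeff a p' =
      if Q (a + Finsupp.single u 1) then MvPolynomial.coeff (a + Finsupp.single u 1) p else 0 := by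
  classical
  refine ⟨∑ m ∈ p.support, if Q m then
    MvPolynomial.monomial (m - Finsupp.single u 1) (MvPolynomial.coeff m p) else 0, fun a => ?_⟩
  rw [MvPolynomial.coeff_sum, Finset.sum_eq_single (a + Finsupp.single u 1)]
  · split_ifs with h <;> simp
  · intro m _ hm
    split_ifs with h
    · rw [MvPolynomial.coeff_monomial, if_neg]
      rintro rfl
      apply hm
      rw [tsub_add_cancel_of_le]
      rw [Finsupp.single_le_iff]
      exact Nat.one_le_iff_ne_zero.2 (hQ m h)
    · simp
  · intro h
    rw [MvPolynomial.notMem_support_iff] at h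
    split_ifs <;> simp [h]

variable [Fintype V] [LinearOrder V]

variable (k r) in
/-- The differential of the Koszul complex of a free module. An element of the Koszul complex
is given by its coefficients with respect to the exterior monomials, which are indexed by the
finite sets of variables. -/
def koszulD : (Finset V → Fin r → MvPolynomial V k) →ₗ[k] (Finset V → Fin r → MvPolynomial V k) :=
  LinearMap.pi fun σ => ∑ u ∈ σᶜ,
    (LinearMap.lsmul (MvPolynomial V k) (Fin r → MvPolynomial V k)
      (MvPolynomial.C (sgn k u σ) * MvPolynomial.X u)).restrictScalars k ∘ₗ
        LinearMap.proj (insert u σ)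

theorem koszulD_apply (ω : Finset V → Fin r → MvPolynomial V k) (σ : Finset V) :
    koszulD k r ω σ = ∑ u ∈ σᶜ,
      (MvPolynomial.C (sgn k u σ) * MvPolynomial.X u : MvPolynomial V k) • ω (insert u σ) := by
  simp [koszulD]

theorem coeff_koszulD (ω : Finset V → Fin r → MvPolynomial V k) (σ : Finset V) (b : Fin r)
    (a : V →₀ ℕ) :
    MvPolynomial.coeff a (koszulD k r ω σ b) = ∑ u ∈ σᶜ, if a u ≠ 0 then
      sgn k u σ * MvPolynomial.coeff (a - Finsupp.single u 1) (ω (insert u σ) b) else 0 := by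
  rw [koszulD_apply, Finset.sum_apply, MvPolynomial.coeff_sum]
  refine Finset.sum_congr rfl fun u _ => ?_
  rw [Pi.smul_apply, smul_eq_mul, coeff_C_mul_X_mul]

theorem koszulD_koszulD (ω : Finset V → Fin r → MvPolynomial V k) :
    koszulD k r (koszulD k r ω) = 0 := by
  funext σ
  simp only [koszulD_apply, Finset.smul_sum, smul_smul, Pi.zero_apply]
  rw [Finset.sum_sigma']
  refine Finset.sum_involution (fun p _ => ⟨p.2, p.1⟩) ?_ ?_ ?_ ?_
  · rintro ⟨u, w⟩ h
    simp only [Finset.mem_sigma, Finset.mem_compl, Finset.mem_insert, not_or] at h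
    obtain ⟨hu, hwu, hw⟩ := h
    have := sgn_insert_mul (k := k) hwu hw hu
    rw [Finset.insert_comm u w, ← add_smul]
    convert zero_smul (MvPolynomial V k) _
    have h2 := congrArg (MvPolynomial.C (σ := V)) this
    simp only [map_mul, map_neg] at h2
    linear_combination (MvPolynomial.X u * MvPolynomial.X w) * h2
  · rintro ⟨u, w⟩ h _ heq
    simp only [Finset.mem_sigma, Finset.mem_compl, Finset.mem_insert, not_or] at h
    exact h.2.1 (congrArg Sigma.fst heq)
  · rintro ⟨u, w⟩ h
    simp only [Finset.mem_sigma, Finset.mem_compl, Finset.mem_insert, not_or] at h ⊢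
    exact ⟨h.2.2, fun h' => h.2.1 h'.symm, h.1⟩
  · rintro ⟨u, w⟩ _
    rfl

/-- The exterior generators have degree 1, so removing one from the set while multiplying by its
variable preserves total degree. -/
theorem koszulD_koszulProj (s : Fin r → ℤ) (q : ℕ) (j : ℤ)
    (ω : Finset V → Fin r → MvPolynomial V k) :
    koszulD k r (koszulProj s (q + 1) j ω) = koszulProj s q j (koszulD k r ω) := by
  funext σ
  rw [koszulD_apply, koszulProj]
  split_ifs with hσ
  · rw [koszulD_apply, map_sum]
    refine Finset.sum_congr rfl fun u hu => ?_
    rw [gradedProj_smul, koszulProj,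
      if_pos (by rw [Finset.card_insert_of_notMem (Finset.mem_compl.1 hu), hσ])]
    congr 3
    push_cast; ring
  · refine Finset.sum_eq_zero fun u hu => ?_
    rw [koszulProj, if_neg (by
      rw [Finset.card_insert_of_notMem (Finset.mem_compl.1 hu)]; omega), smul_zero]

theorem koszulD_mem {s : Fin r → ℤ} {q : ℕ} {j : ℤ}
    {ω : Finset V → Fin r → MvPolynomial V k} (h : ω ∈ koszulPiece s (q + 1) j) :
    koszulD k r ω ∈ koszulPiece s q j := by
  rw [← koszulProj_of_mem h, koszulD_koszulProj]
  exact koszulProj_mem _ _ _ _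

theorem exists_koszulPiece_of_koszulD_eq {s : Fin r → ℤ} {q : ℕ} {j : ℤ}
    {ω η : Finset V → Fin r → MvPolynomial V k} (h : ω ∈ koszulPiece s q j)
    (hη : koszulD k r η = ω) : ∃ η' ∈ koszulPiece s (q + 1) j, koszulD k r η' = ω :=
  ⟨koszulProj s (q + 1) j η, koszulProj_mem _ _ _ _, by
    rw [koszulD_koszulProj, hη, koszulProj_of_mem h]⟩

/-! #### A homotopy in chosen multidegrees -/

/-- The exponent vector of the product of the variables in `σ`. -/
def ind (σ : Finset V) : V →₀ ℕ := Finsupp.equivFunOnFinite.symm fun v => if v ∈ σ then 1 else 0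

theorem ind_apply (σ : Finset V) (v : V) : ind σ v = if v ∈ σ then 1 else 0 := rfl

theorem ind_insert {u : V} {σ : Finset V} (hu : u ∉ σ) :
    ind (insert u σ) = Finsupp.single u 1 + ind σ := by
  classical
  ext v
  rw [Finsupp.add_apply, ind_apply, ind_apply, Finsupp.single_apply]
  by_cases h : u = v
  · subst h; simp [hu]
  · simp [h, Ne.symm h]

theorem ind_erase {u : V} {σ : Finset V} (hu : u ∈ σ) :
    Finsupp.single u 1 + ind (σ.erase u) = ind σ := by
  rw [← ind_insert (Finset.notMem_erase u σ), Finset.insert_erase hu]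

theorem degree_ind (σ : Finset V) : (ind σ).degree = σ.card := by
  rw [Finsupp.degree_eq_sum]
  simp [ind_apply]

theorem support_ind (σ : Finset V) : (ind σ).support = σ := by
  ext v; simp [ind_apply]

/-- Given a variable `χ b` for some of the multidegrees `b`, with `χ b` dividing `b`, there is a
homotopy between `0` and the projection to these multidegrees. -/
theorem exists_koszul_homotopy (χ : (V →₀ ℕ) → Option V) (hχ : ∀ b u, χ b = some u → b u ≠ 0)
    (ω : Finset V → Fin r → MvPolynomial V k) :
    ∃ η : Finset V → Fin r → MvPolynomial V k, ∀ (σ : Finset V) (b : Fin r) (a : V →₀ ℕ),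
      (χ (a + ind σ) = none → MvPolynomial.coeff a (koszulD k r η σ b) = 0) ∧
      ∀ u, χ (a + ind σ) = some u → MvPolynomial.coeff a (koszulD k r η σ b) =
        MvPolynomial.coeff a (ω σ b) - if u ∈ σ then sgn k u σ * MvPolynomial.coeff
          (a + Finsupp.single u 1) (koszulD k r ω (σ.erase u) b) else 0 := by
  classical
  have hex : ∀ (σ : Finset V) (b : Fin r) (u : V), ∃ p' : MvPolynomial V k, u ∈ σ →
      ∀ a, MvPolynomial.coeff a p' = if χ (a + ind σ) = some u then
        MvPolynomial.coeff (a + Finsupp.single u 1) (ω (σ.erase u) b) else 0 := by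
    intro σ b u
    by_cases hu : u ∈ σ
    · obtain ⟨p', hp'⟩ := exists_coeff_eq_shift (ω (σ.erase u) b) u
        (fun m => χ (m + ind (σ.erase u)) = some u) fun m hm => by
          have := hχ _ _ hm
          rwa [Finsupp.add_apply, ind_apply, if_neg (Finset.notMem_erase u σ), add_zero] at this
      refine ⟨p', fun _ a => ?_⟩
      rw [hp', add_assoc, ind_erase hu]
    · exact ⟨0, fun h => absurd h hu⟩
  choose P hP using hex
  -- The homotopy applied to `ω`: in a multidegree with chosen variable `u`, divide the coefficient
  -- by `x_u` and wedge with the exterior generator of `u`.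
  let η : Finset V → Fin r → MvPolynomial V k := fun σ b =>
    ∑ u ∈ σ, MvPolynomial.C (sgn k u σ) * P σ b u
  have hη : ∀ (σ : Finset V) (b : Fin r) (a : V →₀ ℕ), MvPolynomial.coeff a (η σ b) =
      ∑ u ∈ σ, if χ (a + ind σ) = some u then sgn k u σ *
        MvPolynomial.coeff (a + Finsupp.single u 1) (ω (σ.erase u) b) else 0 := by
    intro σ b a
    rw [MvPolynomial.coeff_sum]
    refine Finset.sum_congr rfl fun u hu => ?_
    rw [MvPolynomial.coeff_C_mul, hP σ b u hu, mul_ite, mul_zero]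
  have hη_none : ∀ (σ : Finset V) (b : Fin r) (a : V →₀ ℕ), χ (a + ind σ) = none →
      MvPolynomial.coeff a (η σ b) = 0 := by
    intro σ b a h
    rw [hη]
    simp [h]
  have hη_some : ∀ (σ : Finset V) (b : Fin r) (a : V →₀ ℕ) (u : V), χ (a + ind σ) = some u →
      MvPolynomial.coeff a (η σ b) = if u ∈ σ then sgn k u σ *
        MvPolynomial.coeff (a + Finsupp.single u 1) (ω (σ.erase u) b) else 0 := by
    intro σ b a u h
    rw [hη]
    simp [h]
  -- The Koszul differential preserves the multidegree `a + ind σ`, hence the variable chosen by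
  -- `χ`.
  have hdeg : ∀ (σ : Finset V) (a : V →₀ ℕ) (w : V), w ∉ σ → a w ≠ 0 →
      a - Finsupp.single w 1 + ind (insert w σ) = a + ind σ := by
    intro σ a w hw ha
    rw [ind_insert hw, ← add_assoc, tsub_add_cancel_of_le]
    rw [Finsupp.single_le_iff]
    exact Nat.one_le_iff_ne_zero.2 ha
  refine ⟨η, fun σ b a => ⟨fun h => ?_, fun u h => ?_⟩⟩
  · rw [coeff_koszulD]
    refine Finset.sum_eq_zero fun w hw => ?_
    split_ifs with ha
    · rw [hη_none, mul_zero]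
      rw [hdeg σ a w (Finset.mem_compl.1 hw) ha, h]
    · rfl
  · have key : ∀ w ∈ σᶜ, (if a w ≠ 0 then
        sgn k w σ * MvPolynomial.coeff (a - Finsupp.single w 1) (η (insert w σ) b) else 0) =
        if a w ≠ 0 then (if u ∈ insert w σ then sgn k w σ * (sgn k u (insert w σ) *
          MvPolynomial.coeff (a - Finsupp.single w 1 + Finsupp.single u 1)
            (ω ((insert w σ).erase u) b)) else 0) else 0 := by
      intro w hw
      split_ifs with ha hu
      · rw [hη_some _ _ _ u (by rw [hdeg σ a w (Finset.mem_compl.1 hw) ha, h]), if_pos hu]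
      · rw [hη_some _ _ _ u (by rw [hdeg σ a w (Finset.mem_compl.1 hw) ha, h]), if_neg hu, mul_zero]
      · rfl
    rw [coeff_koszulD, Finset.sum_congr rfl key]
    by_cases hu : u ∈ σ
    · rw [if_pos hu, coeff_koszulD]
      -- In the differential of `ω` at `σ \ {u}`, the term that reinserts `u` gives back the
      -- coefficient of `ω` at `σ`; every other term cancels against one of the differential of `η`.
      have hc : (σ.erase u)ᶜ = insert u σᶜ := by
        ext v; simp only [Finset.mem_compl, Finset.mem_erase, Finset.mem_insert]; tauto
      rw [hc, Finset.sum_insert (by simpa using hu), if_pos (by simp), sgn_erase_self,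
        add_tsub_cancel_right, Finset.insert_erase hu, mul_add, ← mul_assoc, sgn_mul_self, one_mul,
        sub_add_cancel_left, Finset.mul_sum, ← Finset.sum_neg_distrib]
      refine Finset.sum_congr rfl fun w hw => ?_
      have hwσ := Finset.mem_compl.1 hw
      have hwu : w ≠ u := fun e => hwσ (e ▸ hu)
      rw [if_pos (Finset.mem_insert_of_mem hu), Finsupp.add_apply, Finsupp.single_eq_of_ne hwu,
        add_zero]
      split_ifs with ha
      · have hs := sgn_insert_mul (k := k) hwu (σ := σ.erase u)
          (fun h' => hwσ (Finset.mem_of_mem_erase h')) (Finset.notMem_erase u σ)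
        rw [Finset.insert_erase hu, sgn_erase_self,
          ← Finset.erase_insert_of_ne hwu, sgn_erase_self] at hs
        rw [Finset.erase_insert_of_ne hwu]
        have : a - Finsupp.single w 1 + Finsupp.single u 1 =
            a + Finsupp.single u 1 - Finsupp.single w 1 := by
          ext v
          simp only [Finsupp.add_apply, Finsupp.tsub_apply, Finsupp.single_apply]
          by_cases h1 : w = v
          · subst h1; simp [Ne.symm hwu]
          · simp [h1]
        rw [this]
        linear_combination (MvPolynomial.coeff (a + Finsupp.single u 1 - Finsupp.single w 1)
          (ω (insert w (σ.erase u)) b)) * (sgn k u (insert w σ) * sgn k u σ * hs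
            - sgn k w σ * sgn k u (insert w σ) * sgn_mul_self (k := k) u σ
            - sgn k u σ * sgn k w (σ.erase u) * sgn_mul_self (k := k) u (insert w σ))
      · simp
    · have ha : a u ≠ 0 := by
        have := hχ _ _ h
        rwa [Finsupp.add_apply, ind_apply, if_neg hu, add_zero] at this
      -- For `u ∉ σ` only the term inserting `u` survives, where multiplication by `x_u` undoes the
      -- division.
      rw [if_neg hu, sub_zero, Finset.sum_eq_single u]
      · rw [if_pos ha, if_pos (Finset.mem_insert_self u σ), sgn_insert_self, ← mul_assoc,
          sgn_mul_self, one_mul, Finset.erase_insert hu, tsub_add_cancel_of_le]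
        rw [Finsupp.single_le_iff]
        exact Nat.one_le_iff_ne_zero.2 ha
      · intro w _ hw
        rw [if_neg (show u ∉ insert w σ by simp [Ne.symm hw, hu]), ite_self]
      · intro hn
        exact absurd (Finset.mem_compl.2 hu) hn

/-- The homotopy is used with any variable dividing the multidegree. The one multidegree left out,
zero, does not occur in Koszul degree `q + 1 > 0`. -/
theorem koszul_exact {s : Fin r → ℤ} {q : ℕ} {j : ℤ}
    {ω : Finset V → Fin r → MvPolynomial V k} (h : ω ∈ koszulPiece s (q + 1) j)
    (hω : koszulD k r ω = 0) : ∃ η ∈ koszulPiece s (q + 2) j, koszulD k r η = ω := by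
  classical
  let χ : (V →₀ ℕ) → Option V := fun b => if hb : ∃ u, b u ≠ 0 then some hb.choose else none
  obtain ⟨η, hη⟩ := exists_koszul_homotopy χ (fun b u hu => by
    by_cases hb : ∃ u, b u ≠ 0
    · have : χ b = some hb.choose := dif_pos hb
      rw [this, Option.some.injEq] at hu
      exact hu ▸ hb.choose_spec
    · have : χ b = none := dif_neg hb
      simp [this] at hu) ω
  refine exists_koszulPiece_of_koszulD_eq h (η := η) ?_
  funext σ b
  ext a
  by_cases hb : ∃ u, (a + ind σ) u ≠ 0
  · rw [(hη σ b a).2 hb.choose (dif_pos hb), hω]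
    simp
  · rw [(hη σ b a).1 (dif_neg hb), (h σ).2]
    · simp
    · intro hσ
      obtain ⟨v, hv⟩ := Finset.card_pos.1 (by omega : 0 < σ.card)
      exact hb ⟨v, by simp [ind_apply, hv]⟩

end Koszul

/-! ### The double complex of a resolution and the Koszul complex -/

section KoszulMap

variable {k : Type*} [Field k] {V : Type*} {r r' : ℕ}

/-- The map of Koszul complexes induced by a linear map of free modules. -/
def koszulMap (f : (Fin r → MvPolynomial V k) →ₗ[MvPolynomial V k] (Fin r' → MvPolynomial V k)) :
    (Finset V → Fin r → MvPolynomial V k) →ₗ[k] (Finset V → Fin r' → MvPolynomial V k) :=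
  (f.restrictScalars k).compLeft (Finset V)

variable {f : (Fin r → MvPolynomial V k) →ₗ[MvPolynomial V k] (Fin r' → MvPolynomial V k)}

theorem koszulMap_apply (ω : Finset V → Fin r → MvPolynomial V k) (σ : Finset V) :
    koszulMap f ω σ = f (ω σ) := rfl

theorem koszulMap_mem {s : Fin r → ℤ} {s' : Fin r' → ℤ}
    (hf : ∀ j, ∀ x ∈ gradedPiece k s j, f x ∈ gradedPiece k s' j) {q : ℕ} {j : ℤ}
    {ω : Finset V → Fin r → MvPolynomial V k} (h : ω ∈ koszulPiece s q j) :
    koszulMap f ω ∈ koszulPiece s' q j :=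
  fun σ => ⟨fun hσ => hf _ _ ((h σ).1 hσ), fun hσ => by rw [koszulMap_apply, (h σ).2 hσ, map_zero]⟩

theorem koszulMap_koszulD [Fintype V] [LinearOrder V]
    (ω : Finset V → Fin r → MvPolynomial V k) :
    koszulMap f (koszulD k r ω) = koszulD k r' (koszulMap f ω) := by
  funext σ
  simp only [koszulMap_apply, koszulD_apply, map_sum, map_smul]

theorem exists_koszulPiece_of_forall_range {s : Fin r → ℤ} {s' : Fin r' → ℤ}
    (hf : ∀ j, ∀ x ∈ gradedPiece k s j, f x ∈ gradedPiece k s' j) {q : ℕ} {j : ℤ}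
    {ω : Finset V → Fin r' → MvPolynomial V k} (h : ω ∈ koszulPiece s' q j)
    (hω : ∀ σ, ∃ x, f x = ω σ) : ∃ η ∈ koszulPiece s q j, koszulMap f η = ω := by
  choose η hη using hω
  refine ⟨koszulProj s q j η, koszulProj_mem _ _ _ _, ?_⟩
  rw [← koszulProj_of_mem h]
  funext σ
  rw [koszulMap_apply, koszulProj, koszulProj]
  split_ifs
  · rw [map_gradedProj hf, hη]
  · rw [map_zero]

variable {r'' : ℕ}
  {g : (Fin r' → MvPolynomial V k) →ₗ[MvPolynomial V k] (Fin r'' → MvPolynomial V k)}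

theorem koszulMap_koszulMap (hfg : Function.Exact f g) (ω : Finset V → Fin r → MvPolynomial V k) :
    koszulMap g (koszulMap f ω) = 0 := by
  funext σ
  exact hfg.apply_apply_eq_zero _

theorem koszulMap_exact (hfg : Function.Exact f g) {s : Fin r → ℤ} {s' : Fin r' → ℤ}
    (hf : ∀ j, ∀ x ∈ gradedPiece k s j, f x ∈ gradedPiece k s' j) {q : ℕ} {j : ℤ}
    {ω : Finset V → Fin r' → MvPolynomial V k} (h : ω ∈ koszulPiece s' q j)
    (hω : koszulMap g ω = 0) : ∃ η ∈ koszulPiece s q j, koszulMap f η = ω :=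
  exists_koszulPiece_of_forall_range hf h fun σ => (hfg _).1 (congrFun hω σ)

end KoszulMap

/-! ### Moving along an antidiagonal of the double complex -/

section DoubleComplex

variable {k : Type*} [Field k] {V : Type*} [Fintype V] [LinearOrder V] {rk : ℕ → ℕ}
  (s : (p : ℕ) → Fin (rk p) → ℤ)
  (d : (p : ℕ) → (Fin (rk (p + 1)) → MvPolynomial V k) →ₗ[MvPolynomial V k]
    (Fin (rk p) → MvPolynomial V k)) (j : ℤ)

/-- The sum of the two incoming images at the spot `(p, q)` of the double complex. -/
def images (p q : ℕ) : Submodule k (Finset V → Fin (rk p) → MvPolynomial V k) :=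
  (koszulPiece (s (p + 1)) q j).map (koszulMap (d p)) ⊔
    (koszulPiece (s p) (q + 1) j).map (koszulD k (rk p))

/-- The elements of the spot `(p + 1, q)` whose image under the differential of the resolution is
a Koszul boundary. -/
def cyclesD (p q : ℕ) : Submodule k (Finset V → Fin (rk (p + 1)) → MvPolynomial V k) :=
  koszulPiece (s (p + 1)) q j ⊓
    ((koszulPiece (s p) (q + 1) j).map (koszulD k (rk p))).comap (koszulMap (d p))

/-- The elements of the spot `(p, q + 1)` whose image under the Koszul differential comes from the
resolution. -/
def cyclesV (p q : ℕ) : Submodule k (Finset V → Fin (rk p) → MvPolynomial V k) :=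
  koszulPiece (s p) (q + 1) j ⊓
    ((koszulPiece (s (p + 1)) q j).map (koszulMap (d p))).comap (koszulD k (rk p))

variable {s d}

theorem mem_images {p q : ℕ} {ω : Finset V → Fin (rk p) → MvPolynomial V k} :
    ω ∈ images s d j p q ↔ ∃ η ∈ koszulPiece (s (p + 1)) q j,
      ∃ θ ∈ koszulPiece (s p) (q + 1) j, koszulMap (d p) η + koszulD k (rk p) θ = ω := by
  simp only [images, Submodule.mem_sup, Submodule.mem_map, exists_exists_and_eq_and]

theorem mem_cyclesD {p q : ℕ} {ω : Finset V → Fin (rk (p + 1)) → MvPolynomial V k} :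
    ω ∈ cyclesD s d j p q ↔ ω ∈ koszulPiece (s (p + 1)) q j ∧
      ∃ θ ∈ koszulPiece (s p) (q + 1) j, koszulD k (rk p) θ = koszulMap (d p) ω := Iff.rfl

theorem mem_cyclesV {p q : ℕ} {ω : Finset V → Fin (rk p) → MvPolynomial V k} :
    ω ∈ cyclesV s d j p q ↔ ω ∈ koszulPiece (s p) (q + 1) j ∧
      ∃ η ∈ koszulPiece (s (p + 1)) q j, koszulMap (d p) η = koszulD k (rk p) ω := Iff.rfl

variable (hd : ∀ p j, ∀ x ∈ gradedPiece k (s (p + 1)) j, d p x ∈ gradedPiece k (s p) j)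
include hd

theorem images_le_cyclesV (p q : ℕ) : images s d j p (q + 1) ≤ cyclesV s d j p q := by
  intro ω h
  obtain ⟨η, hη, θ, hθ, rfl⟩ := (mem_images j).1 h
  refine (mem_cyclesV j).2 ⟨Submodule.add_mem _ (koszulMap_mem (hd p) hη) (koszulD_mem hθ),
    koszulD k _ η, koszulD_mem hη, ?_⟩
  rw [map_add, koszulD_koszulD, add_zero, koszulMap_koszulD]

variable (hex : ∀ p, Function.Exact (d (p + 1)) (d p))
include hex

theorem images_le_cyclesD (p q : ℕ) : images s d j (p + 1) q ≤ cyclesD s d j p q := by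
  intro ω h
  obtain ⟨η, hη, θ, hθ, rfl⟩ := (mem_images j).1 h
  refine (mem_cyclesD j).2 ⟨Submodule.add_mem _ (koszulMap_mem (hd (p + 1)) hη) (koszulD_mem hθ),
    koszulMap (d p) θ, koszulMap_mem (hd p) hθ, ?_⟩
  rw [map_add, koszulMap_koszulMap (hex p), zero_add, koszulMap_koszulD]

/-- By exactness of the Koszul complex on one side and of the resolution on the other, both
conditions say that the composite of the two differentials kills `ω`. -/
theorem cyclesD_succ (p q : ℕ) : cyclesD s d j p (q + 1) = cyclesV s d j (p + 1) q := by
  ext ω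
  rw [mem_cyclesD, mem_cyclesV]
  refine and_congr_right fun h => ⟨?_, ?_⟩
  · rintro ⟨θ, _, hθ'⟩
    refine koszulMap_exact (hex p) (hd (p + 1)) (koszulD_mem h) ?_
    rw [koszulMap_koszulD, ← hθ', koszulD_koszulD]
  · rintro ⟨η, _, hη'⟩
    refine koszul_exact (koszulMap_mem (hd p) h) ?_
    rw [← koszulMap_koszulD, ← hη', koszulMap_koszulMap (hex p)]

/-- Turning a corner: each side maps, by its own differential, onto the intersection of the two
images at the spot `(p, q)`, modulo the image of the composite differential. Exactness puts the
kernels inside `images`. -/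
theorem finrank_cyclesD_eq_cyclesV (p q : ℕ) :
    Module.finrank k (Subquotient (cyclesD s d j p q) (images s d j (p + 1) q)) =
      Module.finrank k (Subquotient (cyclesV s d j p q) (images s d j p (q + 1))) := by
  rw [finrank_subquotient_map (koszulMap (d p)) (images_le_cyclesD j hd hex p q),
    finrank_subquotient_map (koszulD k (rk p)) (images_le_cyclesV j hd p q)]
  · have h1 : (cyclesD s d j p q).map (koszulMap (d p)) =
        (cyclesV s d j p q).map (koszulD k (rk p)) := by
      rw [cyclesD, cyclesV, ← Submodule.map_inf_eq_map_inf_comap,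
          ← Submodule.map_inf_eq_map_inf_comap, inf_comm]
    have h2 : (images s d j (p + 1) q).map (koszulMap (d p)) =
        (images s d j p (q + 1)).map (koszulD k (rk p)) := by
      rw [images, images, Submodule.map_sup, Submodule.map_sup, ← Submodule.map_comp,
        ← Submodule.map_comp, ← Submodule.map_comp, ← Submodule.map_comp]
      have e1 : koszulMap (d p) ∘ₗ koszulMap (d (p + 1)) = 0 :=
        LinearMap.ext (koszulMap_koszulMap (hex p))
      have e2 : koszulD (V := V) k (rk p) ∘ₗ koszulD k (rk p) = 0 := LinearMap.ext fun ω => koszulD_koszulD ω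
      have e3 : koszulMap (d p) ∘ₗ koszulD k (rk (p + 1)) = koszulD k (rk p) ∘ₗ koszulMap (d p) :=
        LinearMap.ext fun ω => koszulMap_koszulD ω
      rw [e1, e2, e3, Submodule.map_zero, Submodule.map_zero, bot_sup_eq, sup_bot_eq]
    rw [h1, h2]
  · rintro ω ⟨h, h'⟩
    obtain ⟨θ, hθ, rfl⟩ := koszul_exact h'.1 h
    exact (mem_images j).2 ⟨0, Submodule.zero_mem _, θ, hθ, by simp⟩
  · rintro ω ⟨h, h'⟩
    obtain ⟨η, hη, rfl⟩ := koszulMap_exact (hex p) (hd (p + 1)) h'.1 h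
    exact (mem_images j).2 ⟨η, hη, 0, Submodule.zero_mem _, by simp⟩

theorem finrank_cyclesD (p q : ℕ) :
    Module.finrank k (Subquotient (cyclesD s d j p q) (images s d j (p + 1) q)) =
      Module.finrank k (Subquotient (cyclesV s d j 0 (q + p)) (images s d j 0 (q + p + 1))) := by
  induction p generalizing q with
  | zero => exact finrank_cyclesD_eq_cyclesV j hd hex 0 q
  | succ p ih =>
    rw [finrank_cyclesD_eq_cyclesV j hd hex (p + 1) q, ← cyclesD_succ j hd hex p q, ih (q + 1),
      show q + (p + 1) = q + 1 + p by omega]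

end DoubleComplex

/-! ### Tor and the double complex -/

section Residue

variable {k : Type*} [Field k] {V : Type*} {r : ℕ}

variable (k V r) in
/-- Reduction of the degree zero part of the Koszul complex modulo the variables. -/
def koszulAug : (Finset V → Fin r → MvPolynomial V k) →ₗ[k]
    (Fin r → MvPolynomial V k) ⊗[MvPolynomial V k] ResidueModule k V :=
  ((TensorProduct.mk (MvPolynomial V k) (Fin r → MvPolynomial V k)
    (ResidueModule k V)).flip 1).restrictScalars k ∘ₗ LinearMap.proj ∅

theorem koszulAug_apply (ω : Finset V → Fin r → MvPolynomial V k) :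
    koszulAug k V r ω = ω ∅ ⊗ₜ (1 : ResidueModule k V) := rfl

theorem single_mem_koszulPiece [DecidableEq V] {s : Fin r → ℤ} {j : ℤ}
    {x : Fin r → MvPolynomial V k} (hx : x ∈ gradedPiece k s j) :
    (Pi.single ∅ x : Finset V → Fin r → MvPolynomial V k) ∈ koszulPiece s 0 j := by
  intro σ
  constructor <;> intro h
  · obtain rfl := Finset.card_eq_zero.1 h
    simpa using hx
  · exact Pi.single_eq_of_ne (by rintro rfl; exact h rfl) _

theorem map_koszulAug_koszulPiece (s : Fin r → ℤ) (j : ℤ) :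
    (koszulPiece s 0 j).map (koszulAug k V r) =
      (gradedPiece k s j).map (((TensorProduct.mk (MvPolynomial V k) (Fin r → MvPolynomial V k)
        (ResidueModule k V)).flip 1).restrictScalars k) := by
  classical
  apply le_antisymm
  · rintro _ ⟨ω, hω, rfl⟩
    exact ⟨ω ∅, by simpa using (hω ∅).1 rfl, rfl⟩
  · rintro _ ⟨x, hx, rfl⟩
    exact ⟨Pi.single ∅ x, single_mem_koszulPiece hx, by rw [koszulAug_apply, Pi.single_eq_same]; rfl⟩

theorem tmul_one_eq_zero_iff {x : Fin r → MvPolynomial V k} :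
    x ⊗ₜ[MvPolynomial V k] (1 : ResidueModule k V) = 0 ↔
      x ∈ Ideal.span (Set.range (MvPolynomial.X : V → MvPolynomial V k)) •
        (⊤ : Submodule (MvPolynomial V k) (Fin r → MvPolynomial V k)) := by
  rw [← (TensorProduct.tensorQuotEquivQuotSMul _ _).map_eq_zero_iff,
    TensorProduct.tensorQuotEquivQuotSMul, LinearEquiv.trans_apply, TensorProduct.comm_tmul,
    TensorProduct.quotTensorEquivQuotSMul_mk_one_tmul, Submodule.Quotient.mk_eq_zero]

theorem exists_sum_X_smul [Fintype V] {M : Type*} [AddCommGroup M] [Module (MvPolynomial V k) M]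
    {x : M} (hx : x ∈ Ideal.span (Set.range (MvPolynomial.X : V → MvPolynomial V k)) •
      (⊤ : Submodule (MvPolynomial V k) M)) :
    ∃ c : V → M, ∑ v, (MvPolynomial.X v : MvPolynomial V k) • c v = x := by
  refine Submodule.smul_induction_on hx ?_ ?_
  · intro a ha y _
    obtain ⟨c, rfl⟩ := Ideal.mem_span_range_iff_exists_fun.1 ha
    exact ⟨fun v => c v • y, by simp only [Finset.sum_smul, smul_smul, mul_comm]⟩
  · rintro _ _ ⟨c, rfl⟩ ⟨c', rfl⟩
    exact ⟨c + c', by simp only [Pi.add_apply, smul_add, Finset.sum_add_distrib]⟩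

variable [Fintype V] [LinearOrder V]

theorem koszulAug_koszulD (ω : Finset V → Fin r → MvPolynomial V k) :
    koszulAug k V r (koszulD k r ω) = 0 := by
  rw [koszulAug_apply, tmul_one_eq_zero_iff, koszulD_apply]
  refine Submodule.sum_mem _ fun u _ => Submodule.smul_mem_smul ?_ trivial
  exact Ideal.mul_mem_left _ _ (Ideal.subset_span ⟨u, rfl⟩)

/-- The Koszul complex of a free module resolves its reduction modulo the variables; this is
exactness in Koszul degree 0. -/
theorem koszulAug_eq_zero_iff {s : Fin r → ℤ} {j : ℤ}
    {ω : Finset V → Fin r → MvPolynomial V k} (hω : ω ∈ koszulPiece s 0 j) :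
    koszulAug k V r ω = 0 ↔ ∃ θ ∈ koszulPiece s 1 j, koszulD k r θ = ω := by
  constructor
  · intro h
    rw [koszulAug_apply, tmul_one_eq_zero_iff] at h
    obtain ⟨c, hc⟩ := exists_sum_X_smul h
    -- Only singletons survive the projection, and there the sum is just `c v`.
    refine ⟨koszulProj s 1 j fun σ => ∑ v ∈ σ, c v, koszulProj_mem _ _ _ _, ?_⟩
    rw [koszulD_koszulProj, ← koszulProj_of_mem hω]
    funext σ
    rw [koszulProj, koszulProj]
    split_ifs with hσ
    · obtain rfl := Finset.card_eq_zero.1 hσ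
      rw [← hc, koszulD_apply]
      simp [sgn]
    · rfl
  · rintro ⟨θ, _, rfl⟩
    exact koszulAug_koszulD θ

end Residue

namespace GradedFreeResolution

variable {k : Type*} [Field k] {V : Type*} {I : Ideal (MvPolynomial V k)}
  (F : GradedFreeResolution I)

/-- The ranks of the resolution of `R / I` obtained from a resolution of `I`. -/
abbrev extRank : ℕ → ℕ
  | 0 => 1
  | p + 1 => F.rank p

/-- The shifts of the resolution of `R / I` obtained from a resolution of `I`. -/
abbrev extShift : (p : ℕ) → Fin (F.extRank p) → ℤ
  | 0 => 0
  | p + 1 => F.shift p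

/-- The differentials of the resolution of `R / I` obtained from a resolution of `I`. -/
abbrev extD : (p : ℕ) → (Fin (F.extRank (p + 1)) → MvPolynomial V k) →ₗ[MvPolynomial V k]
    (Fin (F.extRank p) → MvPolynomial V k)
  | 0 => LinearMap.pi fun _ => I.subtype ∘ₗ F.aug
  | p + 1 => F.d p

theorem extD_homogeneous : ∀ (p : ℕ) (j : ℤ), ∀ x ∈ gradedPiece k (F.extShift (p + 1)) j,
    F.extD p x ∈ gradedPiece k (F.extShift p) j
  | 0, j, x, hx => fun _ m hm => by
    rw [F.aug_homogeneous j x hx m hm]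
    exact add_zero j
  | p + 1, j, x, hx => F.d_homogeneous p j x hx

theorem extD_exact : ∀ p : ℕ, Function.Exact (F.extD (p + 1)) (F.extD p)
  | 0 => fun x => by
    rw [← F.exact_aug x]
    constructor
    · intro h
      exact Subtype.ext (congrFun h 0)
    · intro h
      funext b
      exact congrArg Subtype.val h
  | p + 1 => F.exact_d p

/-- For `i = 0` every element is a cycle, and the right side is also automatic: the added
differential `F₀ → R` lands in `I`, which lies in the ideal of the variables. -/
theorem tmul_one_mem_torCycles_iff
    (hI : I ≤ Ideal.span (Set.range (MvPolynomial.X : V → MvPolynomial V k))) :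
    ∀ (i : ℕ) (x : Fin (F.rank i) → MvPolynomial V k),
      (x ⊗ₜ (1 : ResidueModule k V) : F.TorTerm i) ∈ F.torCycles i ↔
        F.extD i x ⊗ₜ[MvPolynomial V k] (1 : ResidueModule k V) = 0
  | 0, x => by
    refine ⟨fun _ => ?_, fun _ => trivial⟩
    rw [tmul_one_eq_zero_iff]
    have : F.extD 0 x = (F.aug x : MvPolynomial V k) • (1 : Fin 1 → MvPolynomial V k) := by
      funext b
      simp
    rw [this]
    exact Submodule.smul_mem_smul (hI (F.aug x).2) trivial
  | i + 1, x => Iff.rfl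

/-- Balancing of Tor. Reduction modulo the variables turns the subquotient at `(i + 1, 0)` into
`Tor_i(I, k)_j`; the antidiagonal then leads to `(0, i + 1)`. -/
theorem gradedBetti_eq [Fintype V] [LinearOrder V]
    (hI : I ≤ Ideal.span (Set.range (MvPolynomial.X : V → MvPolynomial V k))) (i : ℕ) (j : ℤ) :
    F.gradedBetti i j = Module.finrank k
      (Subquotient (cyclesV F.extShift F.extD j 0 i) (images F.extShift F.extD j 0 (i + 1))) := by
  have key := finrank_cyclesD j F.extD_homogeneous F.extD_exact i 0
  rw [zero_add] at key
  rw [← key, finrank_subquotient_map (koszulAug k V (F.rank i))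
    (images_le_cyclesD j F.extD_homogeneous F.extD_exact i 0)]
  · have h1 : (cyclesD F.extShift F.extD j i 0).map (koszulAug k V (F.rank i)) =
        F.torCycles i ⊓ F.torTermPiece i j := by
      have : cyclesD F.extShift F.extD j i 0 =
          koszulPiece (F.shift i) 0 j ⊓ (F.torCycles i).comap (koszulAug k V (F.rank i)) := by
        ext ω
        rw [mem_cyclesD]
        refine and_congr_right fun hω => ?_
        change _ ↔ (ω ∅ ⊗ₜ (1 : ResidueModule k V) : F.TorTerm i) ∈ F.torCycles i
        rw [F.tmul_one_mem_torCycles_iff hI]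
        exact (koszulAug_eq_zero_iff (koszulMap_mem (F.extD_homogeneous i) hω)).symm
      rw [this, ← Submodule.map_inf_eq_map_inf_comap, map_koszulAug_koszulPiece, inf_comm]
      rfl
    have h2 : (images F.extShift F.extD j (i + 1) 0).map (koszulAug k V (F.rank i)) =
        (F.torTermPiece (i + 1) j).map (F.torD i) := by
      have e1 : koszulAug k V (F.rank i) ∘ₗ koszulMap (F.d i) =
        F.torD i ∘ₗ koszulAug k V (F.rank (i + 1)) := rfl
      have e2 : koszulAug k V (F.rank i) ∘ₗ koszulD k (F.rank i) = 0 :=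
        LinearMap.ext fun ω => koszulAug_koszulD ω
      have e3 : F.torTermPiece (i + 1) j =
        (koszulPiece (F.shift (i + 1)) 0 j).map (koszulAug k V _) :=
          (map_koszulAug_koszulPiece _ _).symm
      rw [images, Submodule.map_sup, ← Submodule.map_comp, ← Submodule.map_comp, e3,
        ← Submodule.map_comp]
      erw [e2, e1]
      rw [Submodule.map_zero, sup_bot_eq]
    rw [gradedBetti, h1, h2]
  · rintro ω ⟨h, h'⟩
    obtain ⟨θ, hθ, rfl⟩ := (koszulAug_eq_zero_iff h'.1).1 h
    exact (mem_images j).2 ⟨0, Submodule.zero_mem _, θ, hθ, by simp⟩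

end GradedFreeResolution

/-! ### Edge ideals and independent sets -/

section Independent

variable {k : Type*} [Field k] {V : Type*}

/-- Membership in a monomial ideal is tested monomial by monomial. As the generators are squarefree,
only the support of each exponent matters. -/
theorem mem_edgeIdeal_iff {G : SimpleGraph V} {f : MvPolynomial V k} :
    f ∈ edgeIdeal k G ↔ ∀ m : V →₀ ℕ, MvPolynomial.coeff m f ≠ 0 →
      ∃ a b, G.Adj a b ∧ m a ≠ 0 ∧ m b ≠ 0 := by
  classical
  have h : edgeIdeal k G = Ideal.span ((fun m => MvPolynomial.monomial m (1 : k)) ''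
      {m | ∃ a b, G.Adj a b ∧ m = Finsupp.single a 1 + Finsupp.single b 1}) := by
    rw [edgeIdeal]
    congr 1
    ext f
    constructor
    · rintro ⟨a, b, hab, rfl⟩
      exact ⟨_, ⟨a, b, hab, rfl⟩, by simp [MvPolynomial.X, MvPolynomial.monomial_mul]⟩
    · rintro ⟨_, ⟨a, b, hab, rfl⟩, rfl⟩
      exact ⟨a, b, hab, by simp [MvPolynomial.X, MvPolynomial.monomial_mul]⟩
  rw [h, MvPolynomial.mem_ideal_span_monomial_image]
  refine forall_congr' fun m => ?_
  rw [MvPolynomial.mem_support_iff]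
  refine imp_congr_right fun _ => ?_
  constructor
  · rintro ⟨_, ⟨a, b, hab, rfl⟩, hle⟩
    refine ⟨a, b, hab, ?_, ?_⟩
    · have := hle a
      rw [Finsupp.add_apply, Finsupp.single_eq_same] at this
      omega
    · have := hle b
      rw [Finsupp.add_apply, Finsupp.single_eq_same] at this
      omega
  · rintro ⟨a, b, hab, ha, hb⟩
    refine ⟨_, ⟨a, b, hab, rfl⟩, fun v => ?_⟩
    -- Without loops, `a ≠ b`, so no exponent of the generator exceeds 1.
    have := hab.ne
    rw [Finsupp.add_apply, Finsupp.single_apply, Finsupp.single_apply]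
    split_ifs with h1 h2 h2
    · exact absurd (h1.trans h2.symm) this
    · subst h1; omega
    · subst h2; omega
    · omega

theorem edgeIdeal_le_span_X (G : SimpleGraph V) :
    edgeIdeal k G ≤ Ideal.span (Set.range (MvPolynomial.X : V → MvPolynomial V k)) := by
  refine Ideal.span_le.2 ?_
  rintro _ ⟨a, b, _, rfl⟩
  exact Ideal.mul_mem_left _ _ (Ideal.subset_span ⟨b, rfl⟩)

theorem gradedProj_mem_edgeIdeal {G : SimpleGraph V} {s : Fin 1 → ℤ} {j : ℤ}
    {x : Fin 1 → MvPolynomial V k} (hx : x 0 ∈ edgeIdeal k G) :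
    gradedProj k s j x 0 ∈ edgeIdeal k G := by
  rw [mem_edgeIdeal_iff] at hx ⊢
  intro m hm
  rw [coeff_gradedProj] at hm
  split_ifs at hm
  · exact hx m hm
  · exact absurd rfl hm

variable {S : Finset V}

/-- A set of vertices of an induced subgraph, as a set of vertices of the graph. -/
def extendSet (τ : Finset (S : Set V)) : Finset V := τ.map (Function.Embedding.subtype _)

theorem extendSet_subset (τ : Finset (S : Set V)) : extendSet τ ⊆ S := by
  intro v hv
  obtain ⟨w, _, rfl⟩ := Finset.mem_map.1 hv
  exact w.2

theorem card_extendSet (τ : Finset (S : Set V)) : (extendSet τ).card = τ.card :=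
  Finset.card_map _

theorem exists_extendSet_eq {T : Finset V} (h : T ⊆ S) :
    ∃ τ : Finset (S : Set V), extendSet τ = T := by
  classical
  refine ⟨T.subtype (· ∈ (S : Set V)), ?_⟩
  rw [extendSet, Finset.subtype_map_of_mem]
  exact h

theorem extendSet_erase [DecidableEq V] [DecidableEq (S : Set V)] (τ : Finset (S : Set V))
    (v : (S : Set V)) : extendSet (τ.erase v) = (extendSet τ).erase v := by
  rw [extendSet, extendSet, ← Function.Embedding.subtype_apply, ← Finset.map_erase]

theorem face_iff (G : SimpleGraph V) (τ : Finset (S : Set V)) :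
    (τ = ∅ ∨ τ ∈ cliqueComplex (G.induce (S : Set V))ᶜ) ↔
      ∀ a ∈ extendSet τ, ∀ b ∈ extendSet τ, ¬ G.Adj a b := by
  have h : (τ = ∅ ∨ τ ∈ cliqueComplex (G.induce (S : Set V))ᶜ) ↔
      (G.induce (S : Set V))ᶜ.IsClique (τ : Set (S : Set V)) := by
    constructor
    · rintro (rfl | h)
      · simp
      · exact h.2
    · intro h
      rcases τ.eq_empty_or_nonempty with h' | h'
      · exact Or.inl h'
      · exact Or.inr ⟨h', h⟩
  rw [h]
  constructor
  · intro hc a ha b hb hab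
    obtain ⟨a, ha', rfl⟩ := Finset.mem_map.1 ha
    obtain ⟨b, hb', rfl⟩ := Finset.mem_map.1 hb
    have := hc ha' hb' (fun e => hab.ne (congrArg _ e))
    rw [SimpleGraph.compl_adj] at this
    exact this.2 hab
  · intro hc a ha b hb hab
    rw [SimpleGraph.compl_adj]
    exact ⟨hab, hc a (Finset.mem_map_of_mem _ ha) b (Finset.mem_map_of_mem _ hb)⟩

end Independent

/-! ### The simplicial boundary -/

section Boundary

variable {k : Type*} [Field k] {W : Type*} [LinearOrder W]

theorem boundary_single (τ : Finset W) :
    boundary k (Finsupp.single τ 1) = ∑ v ∈ τ, Finsupp.single (τ.erase v) (sgn k v τ) := by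
  simp [boundary, sgn]

theorem boundary_boundary (x : Finset W →₀ k) : boundary k (boundary k x) = 0 := by
  suffices h : boundary (W := W) k ∘ₗ boundary k = 0 from LinearMap.congr_fun h x
  have h1 : ∀ (τ : Finset W) (c : k), boundary k (Finsupp.single τ c) =
      ∑ v ∈ τ, Finsupp.single (τ.erase v) (c * sgn k v τ) := by
    intro τ c
    rw [← mul_one c, ← smul_eq_mul, ← Finsupp.smul_single, map_smul, boundary_single,
      Finset.smul_sum]
    simp
  refine Finsupp.lhom_ext fun τ c => ?_
  simp only [LinearMap.comp_apply, h1, map_sum, LinearMap.zero_apply]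
  rw [Finset.sum_sigma']
  refine Finset.sum_involution (fun p _ => ⟨p.2, p.1⟩) ?_ ?_ ?_ ?_
  · rintro ⟨u, w⟩ h
    simp only [Finset.mem_sigma, Finset.mem_erase] at h
    obtain ⟨hu, hwu, hw⟩ := h
    rw [Finset.erase_right_comm, ← Finsupp.single_add]
    have hu' : insert w ((τ.erase u).erase w) = τ.erase u := Finset.insert_erase (by simp [hw, hwu])
    have hw' : insert u ((τ.erase u).erase w) = τ.erase w := by
      rw [Finset.erase_right_comm, Finset.insert_erase (by simp [hu, Ne.symm hwu])]
    have hs := sgn_insert_mul (k := k) (σ := (τ.erase u).erase w) hwu (Finset.notMem_erase _ _)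
      (by simp)
    rw [hu', hw', sgn_erase_self, sgn_erase_self w (τ.erase u), Finset.erase_right_comm,
      sgn_erase_self, sgn_erase_self u τ] at hs
    have hz : c * sgn k u τ * sgn k w (τ.erase u) + c * sgn k w τ * sgn k u (τ.erase w) = 0 := by
      linear_combination c * hs
    rw [hz, Finsupp.single_zero]
  · rintro ⟨u, w⟩ h _ heq
    simp only [Finset.mem_sigma, Finset.mem_erase] at h
    exact h.2.1 (congrArg Sigma.fst heq)
  · rintro ⟨u, w⟩ h
    simp only [Finset.mem_sigma, Finset.mem_erase] at h ⊢
    exact ⟨h.2.2, fun h' => h.2.1 h'.symm, h.1⟩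
  · rintro ⟨u, w⟩ _
    rfl

theorem linearMap_eqOn_supported {α M : Type*} [AddCommGroup M] [Module k M]
    {φ ψ : (α →₀ k) →ₗ[k] M} {s : Set α}
    (h : ∀ a ∈ s, φ (Finsupp.single a 1) = ψ (Finsupp.single a 1)) {x : α →₀ k}
    (hx : x ∈ Finsupp.supported k k s) : φ x = ψ x := by
  rw [Finsupp.supported_eq_span_single] at hx
  refine LinearMap.eqOn_span (s := (fun i => Finsupp.single i (1 : k)) '' s) ?_ hx
  rintro _ ⟨a, ha, rfl⟩
  exact h a ha

theorem boundary_mem_chains {K : AbstractSimplicialComplex W} {n : ℤ} {x : Finset W →₀ k}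
    (hx : x ∈ chains k K (n + 1)) : boundary k x ∈ chains k K n := by
  rw [chains, Finsupp.supported_eq_span_single] at hx
  refine (Submodule.span_le (p := (chains k K n).comap (boundary k))).2 ?_ hx
  rintro _ ⟨τ, ⟨hτ, hc⟩, rfl⟩
  change boundary k (Finsupp.single τ 1) ∈ chains k K n
  rw [boundary_single]
  refine Submodule.sum_mem _ fun v hv => Finsupp.single_mem_supported k _ ⟨?_, ?_⟩
  · rcases (τ.erase v).eq_empty_or_nonempty with h | h
    · exact Or.inl h
    · rcases hτ with rfl | hτ
      · simp at hv
      · exact Or.inr ((K.isRelLowerSet_faces hτ).2 (Finset.erase_subset _ _) h)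
  · have := Finset.card_erase_add_one hv
    omega

end Boundary

/-! ### Squarefree multidegrees and reduced homology -/

section Squarefree

variable {k : Type*} [Field k] {V : Type*} [LinearOrder V]

variable (k) in
/-- The sign relating the Koszul complex in the squarefree multidegree `S` to cochains. -/
def dualSign (S T : Finset V) : k := ∏ u ∈ T, sgn k u S

theorem dualSign_mul_self (S T : Finset V) : dualSign k S T * dualSign k S T = 1 := by
  rw [dualSign, ← Finset.prod_mul_distrib]
  exact Finset.prod_eq_one fun u _ => sgn_mul_self u S

theorem dualSign_ne_zero (S T : Finset V) : dualSign k S T ≠ 0 := fun h => by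
  have := dualSign_mul_self (k := k) S T
  simp [h] at this

theorem sgn_extendSet {S : Finset V} (τ : Finset (S : Set V)) (v : (S : Set V)) :
    sgn k (v : V) (extendSet τ) = sgn k v τ := by
  rw [sgn, sgn, extendSet, Finset.filter_map, Finset.card_map]
  rfl

variable [Fintype V]

variable (k) in
/-- The value at `T` of the cochain of the squarefree multidegree `S` defined by an element of the
Koszul complex. -/
def cochainValue (S T : Finset V) : (Finset V → Fin 1 → MvPolynomial V k) →ₗ[k] k :=
  dualSign k S T • (MvPolynomial.lcoeff k (ind T) ∘ₗ LinearMap.proj 0 ∘ₗ LinearMap.proj (S \ T))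

theorem cochainValue_apply (S T : Finset V) (ω : Finset V → Fin 1 → MvPolynomial V k) :
    cochainValue k S T ω = dualSign k S T * MvPolynomial.coeff (ind T) (ω (S \ T) 0) := rfl

/-- The Koszul sign counts the elements of `S \ T` below `u`, the simplicial sign those of `T`.
Their product is the sign of `u` in `S`, and this is the factor by which `dualSign` changes when `u`
leaves `T`. -/
theorem cochainValue_koszulD {S T : Finset V} (hT : T ⊆ S)
    (ω : Finset V → Fin 1 → MvPolynomial V k) :
    cochainValue k S T (koszulD k 1 ω) =
      ∑ u ∈ T, sgn k u T * cochainValue k S (T.erase u) ω := by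
  rw [cochainValue_apply, coeff_koszulD, ← Finset.sum_filter]
  have hf : ((S \ T)ᶜ.filter fun u => ind T u ≠ 0) = T := by
    ext u
    simp only [Finset.mem_filter, Finset.mem_compl, Finset.mem_sdiff, ind_apply, ne_eq,
      ite_eq_right_iff, one_ne_zero, imp_false, not_not]
    tauto
  rw [hf, Finset.mul_sum]
  refine Finset.sum_congr rfl fun u hu => ?_
  have h1 : S \ T.erase u = insert u (S \ T) := by
    ext v
    simp only [Finset.mem_sdiff, Finset.mem_erase, Finset.mem_insert]
    by_cases hv : v = u
    · subst hv; simp [hT hu]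
    · simp [hv]
  have h2 : ind T - Finsupp.single u 1 = ind (T.erase u) := by
    rw [← ind_erase hu, add_tsub_cancel_left]
  have h3 : dualSign k S T = sgn k u S * dualSign k S (T.erase u) :=
    (Finset.mul_prod_erase T _ hu).symm
  rw [cochainValue_apply, h1, h2, h3, ← sgn_sdiff_mul hT u]
  linear_combination (sgn k u T * dualSign k S (T.erase u) *
    MvPolynomial.coeff (ind (T.erase u)) (ω (insert u (S \ T)) 0)) *
      sgn_mul_self (k := k) u (S \ T)

/-- Cochains in the squarefree multidegrees of total degree `j` come from elements of the Koszul
complex that are concentrated in these multidegrees. -/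
theorem exists_cochainValue_eq (g : Finset V → Finset V → k) (q j : ℕ) :
    ∃ ω ∈ koszulPiece (0 : Fin 1 → ℤ) q (j : ℤ),
      (∀ S T : Finset V, T ⊆ S → S.card = j → (S \ T).card = q → cochainValue k S T ω = g S T) ∧
      ∀ (σ : Finset V) (m : V →₀ ℕ), MvPolynomial.coeff m (ω σ 0) ≠ 0 →
        ∃ T, m = ind T ∧ Disjoint T σ ∧ (T ∪ σ).card = j ∧ σ.card = q := by
  classical
  let ω : Finset V → Fin 1 → MvPolynomial V k := fun σ _ => if σ.card = q then
    ∑ T with Disjoint T σ ∧ (T ∪ σ).card = j,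
      MvPolynomial.monomial (ind T) (dualSign k (T ∪ σ) T * g (T ∪ σ) T) else 0
  have hω : ∀ (σ : Finset V) (m : V →₀ ℕ), MvPolynomial.coeff m (ω σ 0) ≠ 0 →
        ∃ T, m = ind T ∧ Disjoint T σ ∧ (T ∪ σ).card = j ∧ σ.card = q := by
    intro σ m hm
    by_cases hσ : σ.card = q
    · simp only [ω, if_pos hσ, MvPolynomial.coeff_sum] at hm
      obtain ⟨T, hT, hT'⟩ := Finset.exists_ne_zero_of_sum_ne_zero hm
      rw [MvPolynomial.coeff_monomial] at hT'
      rw [Finset.mem_filter] at hT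
      refine ⟨T, ?_, hT.2.1, hT.2.2, hσ⟩
      by_contra h
      exact hT' (if_neg (Ne.symm h))
    · simp [ω, hσ] at hm
  refine ⟨ω, fun σ => ⟨fun hσ b m hm => ?_, fun hσ => ?_⟩, fun S T hT hS hq => ?_, hω⟩
  · obtain rfl := Subsingleton.elim b 0
    obtain ⟨T, rfl, hd, hc, _⟩ := hω σ m hm
    rw [Finset.card_union_of_disjoint hd] at hc
    rw [degree_ind, Pi.zero_apply]
    omega
  · funext b
    simp [ω, hσ]
  · have hU : T ∪ S \ T = S := Finset.union_sdiff_of_subset hT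
    rw [cochainValue_apply]
    simp only [ω, if_pos hq, MvPolynomial.coeff_sum, MvPolynomial.coeff_monomial]
    rw [Finset.sum_eq_single T]
    · rw [if_pos rfl, hU, ← mul_assoc, dualSign_mul_self, one_mul]
    · intro T' _ hne
      rw [if_neg]
      intro h
      exact hne (by rw [← support_ind T', h, support_ind])
    · intro h
      exact absurd (Finset.mem_filter.2 ⟨Finset.mem_univ _, Finset.disjoint_sdiff, by rw [hU, hS]⟩) h

/-- The Koszul complex of `R / I(G)` is acyclic in the multidegrees that are not squarefree. -/
theorem exists_sub_koszulD_mem_edgeIdeal (G : SimpleGraph V) {q j : ℕ}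
    {ω : Finset V → Fin 1 → MvPolynomial V k} (hω : ω ∈ koszulPiece (0 : Fin 1 → ℤ) q (j : ℤ))
    (hD : ∀ σ, koszulD k 1 ω σ 0 ∈ edgeIdeal k G)
    (hS : ∀ S T : Finset V, S.card = j → T ⊆ S → (∀ a ∈ T, ∀ b ∈ T, ¬ G.Adj a b) →
      cochainValue k S T ω = 0) :
    ∃ θ : Finset V → Fin 1 → MvPolynomial V k,
      ∀ σ, (ω - koszulD k 1 θ) σ 0 ∈ edgeIdeal k G := by
  classical
  let χ : (V →₀ ℕ) → Option V := fun b => if hb : ∃ u, 2 ≤ b u then some hb.choose else none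
  have hχ : ∀ b u, χ b = some u → 2 ≤ b u := by
    intro b u hu
    by_cases hb : ∃ u, 2 ≤ b u
    · have : χ b = some hb.choose := dif_pos hb
      rw [this, Option.some.injEq] at hu
      exact hu ▸ hb.choose_spec
    · have : χ b = none := dif_neg hb
      simp [this] at hu
  obtain ⟨θ, hθ⟩ := exists_koszul_homotopy χ (fun b u hu => by have := hχ b u hu; omega) ω
  refine ⟨θ, fun σ => mem_edgeIdeal_iff.2 fun a ha => ?_⟩
  rw [Pi.sub_apply, Pi.sub_apply, MvPolynomial.coeff_sub] at ha
  by_cases hb : ∃ u, 2 ≤ (a + ind σ) u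
  · have hu : χ (a + ind σ) = some hb.choose := dif_pos hb
    set u := hb.choose
    rw [(hθ σ 0 a).2 u hu, sub_sub_cancel] at ha
    have huσ : u ∈ σ := by
      by_contra h
      exact ha (if_neg h)
    rw [if_pos huσ] at ha
    obtain ⟨x, y, hxy, hx, hy⟩ := mem_edgeIdeal_iff.1 (hD (σ.erase u)) _ (right_ne_zero_of_mul ha)
    -- One of the at least two factors `u` is used by `σ`, so `x_u` still divides `x^a`. Hence `x^a`
    -- and `x_u x^a` have the same support, and `x^a` inherits membership in the ideal.
    have hau : a u ≠ 0 := by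
      have := hχ _ _ hu
      rw [Finsupp.add_apply, ind_apply, if_pos huσ] at this
      omega
    have haux : ∀ z, (a + Finsupp.single u 1 : V →₀ ℕ) z ≠ 0 → a z ≠ 0 := by
      intro z hz
      by_cases h : z = u
      · rwa [h]
      · rwa [Finsupp.add_apply, Finsupp.single_eq_of_ne h, add_zero] at hz
    exact ⟨x, y, hxy, haux x hx, haux y hy⟩
  · rw [(hθ σ 0 a).1 (dif_neg hb), sub_zero] at ha
    -- In a squarefree multidegree `S = supp a ∪ σ`, the coefficient is up to sign the cochain value
    -- at the independent set `supp a`, which vanishes by `hS`.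
    by_contra hind
    push Not at hb hind
    have hle : ∀ v, a v + (if v ∈ σ then 1 else 0) < 2 := hb
    have haT : a = ind a.support := by
      ext v
      have := hle v
      rw [ind_apply]
      simp only [Finsupp.mem_support_iff]
      split_ifs at this ⊢ <;> omega
    have hdisj : Disjoint a.support σ := by
      rw [Finset.disjoint_left]
      intro v hv hvσ
      have := hle v
      rw [if_pos hvσ] at this
      rw [Finsupp.mem_support_iff] at hv
      omega
    have hσ : σ.card = q := by
      by_contra h
      rw [(hω σ).2 h] at ha
      simp at ha
    have hdeg := (hω σ).1 hσ 0 a ha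
    have hdeg' : a.degree = a.support.card := by
      conv_lhs => rw [haT, degree_ind]
    rw [Pi.zero_apply, hdeg'] at hdeg
    have h0 := hS (a.support ∪ σ) a.support
      (by rw [Finset.card_union_of_disjoint hdisj]; omega) Finset.subset_union_left
      (fun x hx y hy hxy => Finsupp.mem_support_iff.1 hy
        (hind x y hxy (Finsupp.mem_support_iff.1 hx)))
    rw [cochainValue_apply, Finset.union_sdiff_cancel_left hdisj, ← haT] at h0
    exact ha ((mul_eq_zero.1 h0).resolve_left (dualSign_ne_zero _ _))

variable {S : Finset V}

variable (k S) in
/-- The cochain on the simplex with vertex set `S` defined by an element of the Koszul complex. -/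
def toCochain : (Finset V → Fin 1 → MvPolynomial V k) →ₗ[k]
    Module.Dual k (Finset (S : Set V) →₀ k) :=
  (Finsupp.llift k k k (Finset (S : Set V))).toLinearMap ∘ₗ
    LinearMap.pi fun τ => cochainValue k S (extendSet τ)

theorem toCochain_single (ω : Finset V → Fin 1 → MvPolynomial V k) (τ : Finset (S : Set V)) :
    toCochain k S ω (Finsupp.single τ 1) = cochainValue k S (extendSet τ) ω := by
  simp [toCochain]

theorem toCochain_koszulD (ω : Finset V → Fin 1 → MvPolynomial V k)
    (x : Finset (S : Set V) →₀ k) :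
    toCochain k S (koszulD k 1 ω) x = toCochain k S ω (boundary k x) := by
  refine linearMap_eqOn_supported (φ := toCochain k S (koszulD k 1 ω))
    (ψ := toCochain k S ω ∘ₗ boundary k) (s := Set.univ) (fun τ _ => ?_) (by simp)
  rw [LinearMap.comp_apply, boundary_single, map_sum, toCochain_single,
    cochainValue_koszulD (extendSet_subset τ), extendSet, Finset.sum_map]
  refine Finset.sum_congr rfl fun v _ => ?_
  rw [← mul_one (sgn k v τ), ← smul_eq_mul (a := sgn k v τ), ← Finsupp.smul_single, map_smul,
    toCochain_single, extendSet_erase, smul_eq_mul]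
  exact congrArg (· * _) (sgn_extendSet τ v)

end Squarefree

/-! ### Hochster's formula for Koszul homology -/

namespace GradedFreeResolution

variable {k : Type*} [Field k] {V : Type*} {G : SimpleGraph V} (F : GradedFreeResolution (edgeIdeal k G))

theorem exists_extD_zero_eq {x : Fin 1 → MvPolynomial V k} (hx : x 0 ∈ edgeIdeal k G) :
    ∃ y, F.extD 0 y = x := by
  obtain ⟨y, hy⟩ := F.aug_surjective ⟨x 0, hx⟩
  refine ⟨y, funext fun b => ?_⟩
  obtain rfl := Subsingleton.elim b 0
  exact congrArg Subtype.val hy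

variable [Fintype V] [LinearOrder V] {i j : ℕ}

/-- Since `F₀` maps onto `I`, this and `mem_images_zero_iff` describe the cycles and boundaries of
`K ⊗ R/I`, freed from the resolution. -/
theorem mem_cyclesV_zero_iff {ω : Finset V → Fin 1 → MvPolynomial V k} :
    ω ∈ cyclesV F.extShift F.extD (j : ℤ) 0 i ↔
      ω ∈ koszulPiece (0 : Fin 1 → ℤ) (i + 1) (j : ℤ) ∧
        ∀ σ, koszulD k 1 ω σ 0 ∈ edgeIdeal k G := by
  rw [mem_cyclesV]
  refine and_congr_right fun hω => ⟨?_, fun h => ?_⟩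
  · rintro ⟨η, _, hη⟩ σ
    have : koszulD k 1 ω σ 0 = F.extD 0 (η σ) 0 := congrFun (congrFun hη.symm σ) 0
    rw [this]
    exact (F.aug (η σ)).2
  · exact exists_koszulPiece_of_forall_range (F.extD_homogeneous 0) (koszulD_mem hω)
      fun σ => F.exists_extD_zero_eq (h σ)

theorem mem_images_zero_iff {q : ℕ} {ω : Finset V → Fin 1 → MvPolynomial V k}
    (hω : ω ∈ koszulPiece (0 : Fin 1 → ℤ) q (j : ℤ)) :
    ω ∈ images F.extShift F.extD (j : ℤ) 0 q ↔
      ∃ θ : Finset V → Fin 1 → MvPolynomial V k,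
        ∀ σ, (ω - koszulD k 1 θ : Finset V → Fin 1 → MvPolynomial V k) σ 0 ∈ edgeIdeal k G := by
  rw [mem_images]
  constructor
  · rintro ⟨η, _, θ, _, rfl⟩
    refine ⟨θ, fun σ => ?_⟩
    rw [add_sub_cancel_right]
    exact (F.aug (η σ)).2
  · rintro ⟨θ, hθ⟩
    -- The given `θ` need not be homogeneous. Projecting it to its strand is harmless because the
    -- edge ideal is homogeneous.
    have hmem : ω - koszulD k 1 (koszulProj 0 (q + 1) j θ) ∈
        koszulPiece (F.extShift 0) q (j : ℤ) :=
      Submodule.sub_mem _ hω (koszulD_mem (koszulProj_mem _ _ _ _))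
    obtain ⟨η, hη, hη'⟩ := exists_koszulPiece_of_forall_range (F.extD_homogeneous 0) hmem
      fun σ => F.exists_extD_zero_eq (x := (ω - koszulD k 1 (koszulProj 0 (q + 1) j θ)) σ) (by
        by_cases hσ : σ.card = q
        · have : (ω - koszulD k 1 (koszulProj 0 (q + 1) j θ)) σ =
              gradedProj k 0 (j - q) ((ω - koszulD k 1 θ) σ) := by
            rw [koszulD_koszulProj, Pi.sub_apply, Pi.sub_apply, koszulProj, if_pos hσ, map_sub,
              gradedProj_of_mem ((hω σ).1 hσ)]
          rw [this]
          exact gradedProj_mem_edgeIdeal (hθ σ)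
        · rw [(hmem σ).2 hσ]
          exact Submodule.zero_mem _)
    exact ⟨η, hη, _, koszulProj_mem _ _ _ _, by rw [hη', sub_add_cancel]⟩

end GradedFreeResolution

/-! ### Koszul cycles of `R / I(G)` as functionals on reduced homology -/

section Hochster

variable {k : Type*} [Field k] {V : Type*} [Fintype V] [LinearOrder V] {G : SimpleGraph V}
  {S : Finset V} {i j : ℕ}

theorem toCochain_eq_zero_of_mem_edgeIdeal {ω : Finset V → Fin 1 → MvPolynomial V k}
    (hω : ∀ σ, ω σ 0 ∈ edgeIdeal k G) {n : ℤ} {x : Finset (S : Set V) →₀ k}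
    (hx : x ∈ chains k (cliqueComplex (G.induce (S : Set V))ᶜ) n) : toCochain k S ω x = 0 := by
  refine linearMap_eqOn_supported (ψ := 0) (fun τ hτ => ?_) hx
  rw [toCochain_single, cochainValue_apply, LinearMap.zero_apply]
  by_contra h
  obtain ⟨a, b, hab, ha, hb⟩ := mem_edgeIdeal_iff.1 (hω _) _ (right_ne_zero_of_mul h)
  rw [← Finsupp.mem_support_iff, support_ind] at ha hb
  exact (face_iff G τ).1 hτ.1 a ha b hb hab

theorem exists_toCochain_eq (g : (S : Finset V) → Module.Dual k (Finset (S : Set V) →₀ k))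
    (q j : ℕ) : ∃ ω ∈ koszulPiece (0 : Fin 1 → ℤ) q (j : ℤ),
      (∀ S : Finset V, S.card = j → ∀ x ∈ chains k (cliqueComplex (G.induce (S : Set V))ᶜ)
        ((j : ℤ) - q - 1), toCochain k S ω x = g S x) ∧
      ∀ (σ : Finset V) (m : V →₀ ℕ), MvPolynomial.coeff m (ω σ 0) ≠ 0 →
        ∃ T, m = ind T ∧ Disjoint T σ ∧ (T ∪ σ).card = j ∧ σ.card = q := by
  classical
  obtain ⟨ω, hω, hωg, hω'⟩ := exists_cochainValue_eq
    (fun S T => g S (Finsupp.single (T.subtype (· ∈ (S : Set V))) 1)) q j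
  refine ⟨ω, hω, fun S hS x hx => linearMap_eqOn_supported (fun τ hτ => ?_) hx, hω'⟩
  have hc : (τ.card : ℤ) = j - q - 1 + 1 := hτ.2
  rw [toCochain_single, hωg S _ (extendSet_subset τ) hS]
  · congr 2
    ext v
    simp [extendSet]
  · rw [Finset.card_sdiff_of_subset (extendSet_subset τ), card_extendSet, hS]
    omega

/-- The cycles of degree `j - i - 2` of the independence complex of the induced subgraph on `S`. -/
abbrev cyclesOf (k : Type*) [Field k] (G : SimpleGraph V) (i j : ℕ) (S : Finset V) :
    Submodule k (Finset (S : Set V) →₀ k) :=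
  LinearMap.ker (boundary k) ⊓
    chains k (cliqueComplex (G.induce (S : Set V))ᶜ) ((j : ℤ) - (i : ℤ) - 2)

/-- The boundaries of degree `j - i - 2` of the independence complex of the induced subgraph
on `S`. -/
abbrev boundariesOf (k : Type*) [Field k] (G : SimpleGraph V) (i j : ℕ) (S : Finset V) :
    Submodule k (Finset (S : Set V) →₀ k) :=
  (chains k (cliqueComplex (G.induce (S : Set V))ᶜ) ((j : ℤ) - (i : ℤ) - 2 + 1)).map (boundary k)

variable (F : GradedFreeResolution (edgeIdeal k G))

open GradedFreeResolution

theorem toCochain_eq_zero_of_mem_boundariesOf {ω : Finset V → Fin 1 → MvPolynomial V k}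
    (hω : ω ∈ cyclesV F.extShift F.extD (j : ℤ) 0 i) {x : Finset (S : Set V) →₀ k}
    (hx : x ∈ boundariesOf k G i j S) : toCochain k S ω x = 0 := by
  obtain ⟨y, hy, rfl⟩ := hx
  rw [← toCochain_koszulD]
  exact toCochain_eq_zero_of_mem_edgeIdeal (F.mem_cyclesV_zero_iff.1 hω).2 hy

theorem mem_images_iff_toCochain_eq_zero {ω : Finset V → Fin 1 → MvPolynomial V k}
    (hω : ω ∈ cyclesV F.extShift F.extD (j : ℤ) 0 i) :
    ω ∈ images F.extShift F.extD (j : ℤ) 0 (i + 1) ↔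
      ∀ S : Finset V, S.card = j → ∀ x ∈ cyclesOf k G i j S, toCochain k S ω x = 0 := by
  obtain ⟨hωp, hωD⟩ := F.mem_cyclesV_zero_iff.1 hω
  rw [F.mem_images_zero_iff hωp]
  constructor
  · rintro ⟨θ, hθ⟩ S _ x ⟨hx, hx'⟩
    have := toCochain_eq_zero_of_mem_edgeIdeal (ω := ω - koszulD k 1 θ) hθ hx'
    rw [map_sub, LinearMap.sub_apply, toCochain_koszulD, LinearMap.mem_ker.1 hx, map_zero,
      sub_zero] at this
    exact this
  · intro h
    have hg : ∀ S : Finset V, ∃ g : Module.Dual k (Finset (S : Set V) →₀ k), S.card = j →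
        ∀ x ∈ chains k (cliqueComplex (G.induce (S : Set V))ᶜ) ((j : ℤ) - (i : ℤ) - 2),
          toCochain k S ω x = g (boundary k x) := by
      intro S
      by_cases hS : S.card = j
      · obtain ⟨g, hg⟩ := exists_dual_eq_comp (h S hS)
        exact ⟨g, fun _ => hg⟩
      · exact ⟨0, fun h => absurd h hS⟩
    choose g hg using hg
    -- `θ₀` realises the cochains `g`, so subtracting its differential clears `ω` at all independent
    -- sets in squarefree multidegrees. The acyclicity lemma then removes the rest through `θ₁`.
    obtain ⟨θ₀, hθ₀, hθ₀g, _⟩ := exists_toCochain_eq (G := G) g (i + 2) j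
    have hmem : ω - koszulD k 1 θ₀ ∈ koszulPiece (0 : Fin 1 → ℤ) (i + 1) (j : ℤ) :=
      Submodule.sub_mem _ hωp (koszulD_mem hθ₀)
    obtain ⟨θ₁, hθ₁⟩ := exists_sub_koszulD_mem_edgeIdeal G hmem (fun σ => by
      rw [map_sub, koszulD_koszulD, sub_zero]
      exact hωD σ) (fun S T hS hT hind => by
      by_cases hc : (S \ T).card = i + 1
      · obtain ⟨τ, rfl⟩ := exists_extendSet_eq hT
        rw [Finset.card_sdiff_of_subset hT, card_extendSet, hS] at hc
        have hτS : τ.card ≤ j := by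
          rw [← hS, ← card_extendSet]; exact Finset.card_le_card hT
        have hτ : Finsupp.single τ (1 : k) ∈
            chains k (cliqueComplex (G.induce (S : Set V))ᶜ) ((j : ℤ) - (i : ℤ) - 2) :=
          Finsupp.single_mem_supported k _ ⟨(face_iff G τ).2 hind, by omega⟩
        -- `θ₀` has Koszul degree `i + 2`, so its cochains live one dimension lower, on faces of
        -- dimension `j - i - 3`.
        have hτ' := boundary_mem_chains (K := cliqueComplex (G.induce (S : Set V))ᶜ)
          (n := (j : ℤ) - (i + 2 : ℕ) - 1) (by
          rwa [show (j : ℤ) - (i + 2 : ℕ) - 1 + 1 = j - i - 2 by push_cast; ring])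
        rw [← toCochain_single, map_sub, LinearMap.sub_apply, toCochain_koszulD, hg S hS _ hτ,
          hθ₀g S hS _ hτ', sub_self]
      · rw [cochainValue_apply, (hmem _).2 hc]
        simp)
    refine ⟨θ₀ + θ₁, fun σ => ?_⟩
    rw [map_add, ← sub_sub]
    exact hθ₁ σ

/-- The functionals on homology defined by the cycles of the Koszul complex of `R / I(G)`. -/
def cyclesVToDual : cyclesV F.extShift F.extD (j : ℤ) 0 i →ₗ[k]
    ((S : {S : Finset V // S.card = j}) →
      ((boundariesOf k G i j S.1).submoduleOf (cyclesOf k G i j S.1)).dualAnnihilator) :=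
  LinearMap.pi fun S => LinearMap.codRestrict _
    ((cyclesOf k G i j S.1).subtype.dualMap ∘ₗ toCochain k S.1 ∘ₗ
      (cyclesV F.extShift F.extD (j : ℤ) 0 i).subtype)
    fun ω => (Submodule.mem_dualAnnihilator _).2 fun _ hx =>
      toCochain_eq_zero_of_mem_boundariesOf F ω.2 hx

theorem cyclesVToDual_apply (ω : cyclesV F.extShift F.extD (j : ℤ) 0 i)
    (S : {S : Finset V // S.card = j}) (x : cyclesOf k G i j S.1) :
    (cyclesVToDual F ω S : Module.Dual k (cyclesOf k G i j S.1)) x = toCochain k S.1 ω.1 x.1 := rfl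

/-- Extend each functional from cycles to all chains and realise it by a Koszul element in
squarefree multidegrees. Its differential lies in the edge ideal because the functional kills
boundaries. -/
theorem cyclesVToDual_surjective : Function.Surjective (cyclesVToDual (i := i) (j := j) F) := by
  intro ψ
  have hg : ∀ S : Finset V, ∃ g : Module.Dual k (Finset (S : Set V) →₀ k), ∀ hS : S.card = j,
      ∀ x : cyclesOf k G i j S, (ψ ⟨S, hS⟩).1 x = g x := by
    intro S
    by_cases hS : S.card = j
    · obtain ⟨g, hg⟩ := LinearMap.exists_extend (ψ ⟨S, hS⟩).1
      exact ⟨g, fun _ x => (LinearMap.congr_fun hg x).symm⟩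
    · exact ⟨0, fun h => absurd h hS⟩
  choose g hg using hg
  obtain ⟨ω, hω, hωg, hω'⟩ := exists_toCochain_eq (G := G) g (i + 1) j
  have hdeg : (j : ℤ) - (i + 1 : ℕ) - 1 = j - i - 2 := by push_cast; ring
  rw [hdeg] at hωg
  have hωV : ω ∈ cyclesV F.extShift F.extD (j : ℤ) 0 i := by
    refine F.mem_cyclesV_zero_iff.2 ⟨hω, fun σ => mem_edgeIdeal_iff.2 fun m hm => ?_⟩
    by_contra hind
    push Not at hind
    have hm' := hm
    rw [coeff_koszulD] at hm'
    obtain ⟨u, hu, hne⟩ := Finset.exists_ne_zero_of_sum_ne_zero hm'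
    have hmu : m u ≠ 0 := fun h => hne (if_neg (not_not.2 h))
    rw [if_pos hmu] at hne
    obtain ⟨T, hT, hd, hcard, hσ⟩ := hω' _ _ (right_ne_zero_of_mul hne)
    rw [Finset.disjoint_insert_right] at hd
    rw [Finset.mem_compl] at hu
    rw [Finset.card_insert_of_notMem hu, Nat.add_right_cancel_iff] at hσ
    have hmT : m = ind (insert u T) := by
      rw [ind_insert hd.1, ← hT, add_tsub_cancel_of_le]
      rw [Finsupp.single_le_iff]
      exact Nat.one_le_iff_ne_zero.2 hmu
    have hTσ : Disjoint (insert u T) σ := Finset.disjoint_insert_left.2 ⟨hu, hd.2⟩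
    have hUnion : insert u T ∪ σ = T ∪ insert u σ := by
      rw [Finset.insert_union, Finset.union_insert]
    have hS : (insert u T ∪ σ).card = j := by rw [hUnion, hcard]
    obtain ⟨τ, hτ⟩ := exists_extendSet_eq (S := insert u T ∪ σ)
      (T := insert u T) Finset.subset_union_left
    have hτc : Finsupp.single τ (1 : k) ∈ chains k
        (cliqueComplex (G.induce ((insert u T ∪ σ : Finset V) : Set V))ᶜ)
          ((j : ℤ) - (i : ℤ) - 2 + 1) := by
      refine Finsupp.single_mem_supported k _ ⟨(face_iff G τ).2 ?_, ?_⟩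
      · rw [hτ]
        intro a ha b hb hab
        have := hind a b hab
        rw [hmT, ind_apply, ind_apply, if_pos ha, if_pos hb] at this
        simp at this
      · rw [Finset.card_union_of_disjoint hTσ] at hS
        rw [← card_extendSet, hτ]
        omega
    -- If `x^m` were outside the ideal, its support would be a face `τ`, and its coefficient, up to
    -- sign, the functional at the boundary of `τ`, which is zero.
    have hz : boundary k (Finsupp.single τ (1 : k)) ∈ cyclesOf k G i j (insert u T ∪ σ) :=
      ⟨boundary_boundary _, boundary_mem_chains hτc⟩
    have h0 : cochainValue k (insert u T ∪ σ) (extendSet τ) (koszulD k 1 ω) = 0 := by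
      rw [← toCochain_single, toCochain_koszulD, hωg _ hS _ hz.2, ← hg _ hS ⟨_, hz⟩]
      exact (Submodule.mem_dualAnnihilator _).1 (ψ ⟨_, hS⟩).2 _ ⟨_, hτc, rfl⟩
    rw [hτ, cochainValue_apply, Finset.union_sdiff_cancel_left hTσ, ← hmT] at h0
    exact hm ((mul_eq_zero.1 h0).resolve_left (dualSign_ne_zero _ _))
  refine ⟨⟨ω, hωV⟩, funext fun S => Subtype.ext (LinearMap.ext fun x => ?_)⟩
  rw [cyclesVToDual_apply, hg S.1 S.2, hωg S.1 S.2 _ x.2.2]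

theorem gradedBetti_eq_sum :
    F.gradedBetti i (j : ℤ) = ∑ S ∈ Finset.powersetCard j (Finset.univ : Finset V),
      Module.finrank k (ReducedHomology k (cliqueComplex (G.induce (S : Set V))ᶜ)
        ((j : ℤ) - (i : ℤ) - 2)) := by
  rw [F.gradedBetti_eq (edgeIdeal_le_span_X G)]
  have h := finrank_subquotient_of_surjective
    (E' := (S : {S : Finset V // S.card = j}) →
      ((boundariesOf k G i j S.1).submoduleOf (cyclesOf k G i j S.1)).dualAnnihilator)
    (B := images F.extShift F.extD (j : ℤ) 0 (i + 1)) (cyclesVToDual F)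
    (cyclesVToDual_surjective F) ?_
  · rw [h, finrank_pi_dualAnnihilator, Finset.sum_subtype (p := fun S : Finset V => S.card = j) _
      (by simp)]
  · intro ω
    rw [mem_images_iff_toCochain_eq_zero F ω.2]
    constructor
    · intro h S hS x hx
      have := LinearMap.congr_fun (congrArg Subtype.val (congrFun h ⟨S, hS⟩)) ⟨x, hx⟩
      exact this
    · intro h
      exact funext fun S => Subtype.ext (LinearMap.ext fun x => h S.1 S.2 _ x.2)

end Hochster

/-! ### Existence of graded free resolutions -/

section Existence

variable {k : Type*} [Field k] {V : Type*} {r : ℕ}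

theorem exists_sum_gradedProj_eq (s : Fin r → ℤ) (x : Fin r → MvPolynomial V k) :
    ∃ J : Finset ℤ, ∑ j ∈ J, gradedProj k s j x = x := by
  classical
  refine ⟨Finset.univ.biUnion fun b => (x b).support.image fun m => (m.degree : ℤ) + s b, ?_⟩
  ext b m
  rw [Finset.sum_apply, MvPolynomial.coeff_sum]
  simp only [coeff_gradedProj]
  rw [Finset.sum_ite_eq]
  split_ifs with h
  · rfl
  · by_contra hne
    exact h (Finset.mem_biUnion.2 ⟨b, Finset.mem_univ b, Finset.mem_image_of_mem _
      (MvPolynomial.mem_support_iff.2 (Ne.symm hne))⟩)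

theorem smul_mem_gradedPiece {s : Fin r → ℤ} {i j : ℤ} {p : MvPolynomial V k}
    {x : Fin r → MvPolynomial V k} (hp : ∀ m, MvPolynomial.coeff m p ≠ 0 → (m.degree : ℤ) + i = j)
    (hx : x ∈ gradedPiece k s i) : p • x ∈ gradedPiece k s j := by
  classical
  intro b m hm
  rw [Pi.smul_apply, smul_eq_mul, MvPolynomial.coeff_mul] at hm
  obtain ⟨⟨m₁, m₂⟩, hmem, hne⟩ := Finset.exists_ne_zero_of_sum_ne_zero hm
  have h1 := hp m₁ (left_ne_zero_of_mul hne)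
  have h2 := hx b m₂ (right_ne_zero_of_mul hne)
  have h3 : m.degree = m₁.degree + m₂.degree := by
    rw [← map_add, Finset.HasAntidiagonal.mem_antidiagonal.1 hmem]
  omega

/-- A homogeneous submodule of a graded free module is the image of a homogeneous map from a
finitely generated graded free module. -/
theorem exists_range_eq_of_homogeneous [Finite V] (s : Fin r → ℤ)
    (N : Submodule (MvPolynomial V k) (Fin r → MvPolynomial V k))
    (hN : ∀ x ∈ N, ∀ j, gradedProj k s j x ∈ N) :
    ∃ (r' : ℕ) (s' : Fin r' → ℤ)
      (f : (Fin r' → MvPolynomial V k) →ₗ[MvPolynomial V k] (Fin r → MvPolynomial V k)),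
      (∀ j, ∀ x ∈ gradedPiece k s' j, f x ∈ gradedPiece k s j) ∧ LinearMap.range f = N := by
  have hspan : Submodule.span (MvPolynomial V k) {x | x ∈ N ∧ ∃ j, x ∈ gradedPiece k s j} = N := by
    apply le_antisymm
    · exact Submodule.span_le.2 fun x hx => hx.1
    · intro x hx
      obtain ⟨J, hJ⟩ := exists_sum_gradedProj_eq s x
      rw [← hJ]
      exact Submodule.sum_mem _ fun j _ =>
        Submodule.subset_span ⟨hN x hx j, j, gradedProj_mem k s j x⟩
  -- Hilbert's basis theorem, applied to a span of homogeneous elements so that the finite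
  -- generating set can be taken among them.
  have hfg := IsNoetherian.noetherian
    (Submodule.span (MvPolynomial V k) {x | x ∈ N ∧ ∃ j, x ∈ gradedPiece k s j})
  obtain ⟨t, ht, hts⟩ := (Submodule.fg_span_iff_fg_span_finset_subset _).1 hfg
  choose deg hdeg using fun x : t => (ht x.2).2
  let e : Fin t.card ≃ t := t.equivFin.symm
  refine ⟨t.card, fun a => deg (e a),
    Fintype.linearCombination (MvPolynomial V k) (fun a => (e a : Fin r → MvPolynomial V k)),
    fun j x hx => ?_, ?_⟩
  · rw [Fintype.linearCombination_apply]
    exact Submodule.sum_mem _ fun a _ => smul_mem_gradedPiece (hx a) (hdeg (e a))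
  · rw [Fintype.range_linearCombination, ← hspan, hts]
    congr 1
    ext x
    constructor
    · rintro ⟨a, rfl⟩
      exact (e a).2
    · intro hx
      exact ⟨e.symm ⟨x, hx⟩, by simp⟩

variable (k V) in
/-- A homogeneous submodule of a finitely generated graded free module. -/
structure Syzygies where
  /-- the rank of the graded free module -/
  rank : ℕ
  /-- the degrees of its standard basis vectors -/
  shift : Fin rank → ℤ
  /-- the submodule -/
  carrier : Submodule (MvPolynomial V k) (Fin rank → MvPolynomial V k)
  gradedProj_mem : ∀ x ∈ carrier, ∀ j, gradedProj k shift j x ∈ carrier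

namespace Syzygies

variable [Finite V] (N : Syzygies k V)

theorem exists_cover : ∃ (M : Syzygies k V)
    (f : (Fin M.rank → MvPolynomial V k) →ₗ[MvPolynomial V k] (Fin N.rank → MvPolynomial V k)),
    (∀ j, ∀ x ∈ gradedPiece k M.shift j, f x ∈ gradedPiece k N.shift j) ∧
      LinearMap.range f = N.carrier ∧ LinearMap.ker f = M.carrier := by
  obtain ⟨r, s, f, hf, hr⟩ := exists_range_eq_of_homogeneous N.shift N.carrier N.gradedProj_mem
  refine ⟨⟨r, s, LinearMap.ker f, fun x hx j => ?_⟩, f, hf, hr, rfl⟩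
  rw [LinearMap.mem_ker, map_gradedProj hf, LinearMap.mem_ker.1 hx, map_zero]

/-- The relations between chosen homogeneous generators. -/
def next : Syzygies k V := N.exists_cover.choose

/-- The map to the ambient module given by chosen homogeneous generators. -/
def cover : (Fin N.next.rank → MvPolynomial V k) →ₗ[MvPolynomial V k]
    (Fin N.rank → MvPolynomial V k) := N.exists_cover.choose_spec.choose

theorem cover_mem (j : ℤ) (x : Fin N.next.rank → MvPolynomial V k)
    (hx : x ∈ gradedPiece k N.next.shift j) : N.cover x ∈ gradedPiece k N.shift j :=
  N.exists_cover.choose_spec.choose_spec.1 j x hx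

theorem range_cover : LinearMap.range N.cover = N.carrier :=
  N.exists_cover.choose_spec.choose_spec.2.1

theorem ker_cover : LinearMap.ker N.cover = N.next.carrier :=
  N.exists_cover.choose_spec.choose_spec.2.2

theorem cover_exact : Function.Exact N.next.cover N.cover :=
  LinearMap.exact_iff.2 (N.ker_cover.trans N.next.range_cover.symm)

/-- The iterated syzygies. -/
def iter : ℕ → Syzygies k V
  | 0 => N
  | n + 1 => (iter n).next

end Syzygies

variable (k) in
/-- The edge ideal as a homogeneous submodule of the free module of rank one. -/
abbrev edgeSyzygies (G : SimpleGraph V) : Syzygies k V where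
  rank := 1
  shift := 0
  carrier := Submodule.comap
    (LinearMap.proj 0 : (Fin 1 → MvPolynomial V k) →ₗ[MvPolynomial V k] MvPolynomial V k)
    (edgeIdeal k G)
  gradedProj_mem _ hx _ := gradedProj_mem_edgeIdeal hx

/-- The first cover maps onto `I` inside the free module of rank one and becomes the augmentation;
the later covers, each onto the kernel of the one before, are the differentials. -/
theorem nonempty_gradedFreeResolution [Finite V] (G : SimpleGraph V) :
    Nonempty (GradedFreeResolution (edgeIdeal k G)) := by
  let N := edgeSyzygies k G
  have hN : ∀ x, x ∈ LinearMap.range N.cover ↔ x (0 : Fin 1) ∈ edgeIdeal k G := fun x => by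
    rw [N.range_cover]
    rfl
  let aug : (Fin N.next.rank → MvPolynomial V k) →ₗ[MvPolynomial V k] edgeIdeal k G :=
    LinearMap.codRestrict (edgeIdeal k G) (LinearMap.proj (0 : Fin 1) ∘ₗ N.cover)
      fun x => (hN _).1 (LinearMap.mem_range_self _ x)
  have haug : ∀ x, aug x = 0 ↔ N.cover x = 0 := fun x => by
    rw [← Subtype.coe_inj, funext_iff, Fin.forall_fin_one]
    rfl
  exact ⟨{
    rank := fun i => (N.next.iter i).rank
    shift := fun i => (N.next.iter i).shift
    d := fun i => (N.next.iter i).cover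
    aug := aug
    d_homogeneous := fun i => (N.next.iter i).cover_mem
    aug_homogeneous := fun j x hx m hm => (add_zero _).symm.trans (N.cover_mem j x hx (0 : Fin 1) m hm)
    exact_d := fun i => (N.next.iter i).cover_exact
    exact_aug := fun x => (haug x).trans (N.cover_exact x)
    aug_surjective := fun f => by
      obtain ⟨x, hx⟩ := (hN fun _ => f.1).2 f.2
      exact ⟨x, Subtype.ext (congrFun hx (0 : Fin 1))⟩ }⟩

end Existence

end EdgeIdeal

end

theorem proposition1p2 {k : Type*} [Field k] {V : Type*} [Fintype V] [LinearOrder V]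
    (G : SimpleGraph V) :
    Nonempty (EdgeIdeal.GradedFreeResolution (EdgeIdeal.edgeIdeal k G)) ∧
    ∀ (F : EdgeIdeal.GradedFreeResolution (EdgeIdeal.edgeIdeal k G)) (i j : ℕ),
      F.gradedBetti i (j : ℤ) =
        ∑ S ∈ Finset.powersetCard j (Finset.univ : Finset V),
          Module.finrank k
            (EdgeIdeal.ReducedHomology k
              (EdgeIdeal.cliqueComplex (G.induce (S : Set V))ᶜ) ((j : ℤ) - (i : ℤ) - 2)) :=
  ⟨EdgeIdeal.nonempty_gradedFreeResolution G, fun F _ _ => EdgeIdeal.gradedBetti_eq_sum F⟩
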